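/- Let $p\ge 1$ be real, and let $m_0$ (resp. $m_1$) be the least integer strictly greater than $p+\frac12$ (resp. $p-\frac12$). For a probability measure $\nu$ on $\mathbb R$ put $\nu^*(x)=\int e^{iux}\,\nu(du)$, and for an integrable function $f$ put $f^*(x)=\int e^{iux}f(u)\,du$. Let $W_p(\mu,\nu)=\inf_\pi\big(\int|x-y|^p\,\pi(dx,dy)\big)^{1/p}$, the infimum being over all probability measures $\pi$ on $\mathbb R^2$ with marginals $\mu$ and $\nu$. Let $k\ge 0$ be a symmetric function on $\mathbb R$ with $\int k=1$ whose Fourier transform $k^*$ is supported on $[-1,1]$ and is $\lceil p\rceil$ times differentiable with Lipschitz $\lceil p\rceil$-th derivative. Then there is a constant $C$, depending only on $p$ and $k$, such that the following holds. Let $n\ge1$, $0<h\le 1$ and $0\le\rho\le n^{-1/2}$, and let $\mu,\mu_\varepsilon$ be probability measures on $\mathbb R$ such that $\mu_\varepsilon^*$ does not vanish and $r_\varepsilon=1/\mu_\varepsilon^*$ is $m_0$ times continuously differentiable. Let $Y_i=X_i+\varepsilon_i$, $1\le i\le n$, where $X_1,\dots,X_n$ are i.i.d. with law $\mu$, $\varepsilon_1,\dots,\varepsilon_n$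 are i.i.d. with law $\mu_\varepsilon$, and $(X_1,\dots,X_n)$ is independent of $(\varepsilon_1,\dots,\varepsilon_n)$; let $Y$ denote a random variable with the common law of the $Y_i$. Put $$\tilde k_h(x)=\frac1{2\pi}\int\frac{e^{iux}k^*(u)}{\mu_\varepsilon^*(-u/h)}\,du,\qquad \hat F_n(t)=\frac1{nh}\int_{-\infty}^t\sum_{j=1}^n\tilde k_h\Big(\frac{u-Y_j}h\Big)du,$$ and let $\tilde\mu_n$ be a (random) probability measure whose distribution function $\tilde F_n$ satisfies, for every distribution function $G$ of a probability measure on $\mathbb R$, $$\int|x|^{p-1}|\hat F_n-\tilde F_n|(x)\,dx\le\int|x|^{p-1}|\hat F_n-G|(x)\,dx+\rho.$$ Then $$\mathbb E\,W_p^p(\tilde\mu_n,\mu)\le\frac1{\sqrt n}+h^p2^{p-1}\int|x|^pk(x)\,dx+\frac C{\sqrt n}(A_1+A_2+A_3+A_4),$$ where $$A_1=\Big(\sup_{t\in[-2,2]}\sum_{\ell=0}^{1}|r_\varepsilon^{(\ell)}(t)|\Big)\int_0^\infty|x|^{p-1}\sqrt{\mathbb P(|Y|\ge x)}\,dx,\qquad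 A_2=\sup_{t\in[-2,2]}\sum_{\ell=0}^{m_0}|r_\varepsilon^{(\ell)}(t)|,$$ $$A_3=\Big[\mathbb E|Y|^{2p-\frac12}\int_{-1/h}^{1/h}\frac{|r_\varepsilon(x)|^2}{|x|^2}\mathbf 1_{[-1,1]^c}(x)\,dx\Big]^{1/2},\qquad A_4=\Big[\sum_{\ell=0}^{m_1}\int_{-1/h}^{1/h}\frac{|r_\varepsilon^{(\ell)}(x)|^2}{|x|^2}\mathbf 1_{[-1,1]^c}(x)\,dx\Big]^{1/2}.$$ All quantities are in $[0,\infty]$, with $0\cdot\infty=0$; the inequality is trivial when the right-hand side is infinite. -/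

import Mathlib

open MeasureTheory ProbabilityTheory Set
open scoped ENNReal NNReal

namespace WassersteinDeconvolution

/-- The Wasserstein distance of order `p` between two measures on the real line: the infimum of
`(∫ |x - y|^p dπ)^(1/p)` over all couplings `π` of `μ` and `ν`, with values in `[0, ∞]`. -/
noncomputable def wasserstein (p : ℝ) (μ ν : Measure ℝ) : ℝ≥0∞ :=
  ⨅ π ∈ {π : Measure (ℝ × ℝ) | IsProbabilityMeasure π ∧ π.fst = μ ∧ π.snd = ν},
    (∫⁻ z, ENNReal.ofReal (|z.1 - z.2| ^ p) ∂π) ^ (1 / p)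

/-- The Fourier transform `f^*(x) = ∫ e^{iux} f(u) du`. -/
noncomputable def fourierStar (f : ℝ → ℝ) (x : ℝ) : ℂ :=
  ∫ u : ℝ, Complex.exp (Complex.I * u * x) * f u

/-- The least integer strictly greater than `x`, for `x ≥ 0`. -/
noncomputable def leastGt (x : ℝ) : ℕ := ⌊x⌋₊ + 1

/-- The kernels admitted in the construction: symmetric probability densities whose Fourier
transform is supported on `[-1, 1]` and is `⌈p⌉` times differentiable with Lipschitz `⌈p⌉`-th
derivative. -/
structure IsKernel (p : ℝ) (k : ℝ → ℝ) : Prop where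
  nonneg : ∀ x, 0 ≤ k x
  symm : ∀ x, k (-x) = k x
  integrable : Integrable k
  integral_eq_one : ∫ x, k x = 1
  contDiff : ContDiff ℝ (⌈p⌉₊ : ℕ) (fourierStar k)
  lipschitz : ∃ L : ℝ≥0, LipschitzWith L (iteratedDeriv ⌈p⌉₊ (fourierStar k))
  support : ∀ u, 1 < |u| → fourierStar k u = 0

/-- The function `r_ε = 1 / μ_ε^*`. -/
noncomputable def recipChar (με : Measure ℝ) (t : ℝ) : ℂ := 1 / charFun με t

/-- The deconvolution kernel `(2π)⁻¹ ∫ e^{iux} k^*(u) / μ_ε^*(-u/h) du`. The integral is a real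
number, so that taking the real part only changes the type. -/
noncomputable def deconvKernel (k : ℝ → ℝ) (με : Measure ℝ) (h x : ℝ) : ℝ :=
  (1 / (2 * (Real.pi : ℂ)) *
    ∫ u : ℝ, Complex.exp (Complex.I * u * x) * fourierStar k u / charFun με (-u / h)).re

/-- The preliminary estimator `F̂_n(t)` of the distribution function, from the data `y`. -/
noncomputable def prelimEstimator {n : ℕ} (k : ℝ → ℝ) (με : Measure ℝ) (h : ℝ) (y : Fin n → ℝ)
    (t : ℝ) : ℝ :=
  1 / (n * h) * ∫ u in Iic t, ∑ j, deconvKernel k με h ((u - y j) / h)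

/-- The weighted distance `∫ |x|^{p-1} |F - G|(x) dx`. -/
noncomputable def weightedDist (p : ℝ) (F G : ℝ → ℝ) : ℝ≥0∞ :=
  ∫⁻ x : ℝ, ENNReal.ofReal (|x| ^ (p - 1) * |F x - G x|)

/-- The distribution function of the probability measure `m` minimizes, up to `ρ`, the weighted
distance to `Fhat` among all distribution functions. -/
def IsIsotoneApprox (p ρ : ℝ) (Fhat : ℝ → ℝ) (m : ProbabilityMeasure ℝ) : Prop :=
  ∀ G : ProbabilityMeasure ℝ,
    weightedDist p Fhat (cdf (m : Measure ℝ)) ≤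
      weightedDist p Fhat (cdf (G : Measure ℝ)) + ENNReal.ofReal ρ

/-- `sup_{t ∈ [-2,2]} ∑_{ℓ=0}^{m} |r^{(ℓ)}(t)|`. -/
noncomputable def supDeriv (r : ℝ → ℂ) (m : ℕ) : ℝ≥0∞ :=
  ⨆ t ∈ Icc (-2 : ℝ) 2, ∑ l ∈ Finset.range (m + 1), ENNReal.ofReal ‖iteratedDeriv l r t‖

/-- `∫_{-1/h}^{1/h} |r^{(ℓ)}(x)|² / |x|² 1_{[-1,1]^c}(x) dx`. -/
noncomputable def outerIntegral (r : ℝ → ℂ) (h : ℝ) (l : ℕ) : ℝ≥0∞ :=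
  ∫⁻ x in Icc (-(1 / h)) (1 / h) ∩ (Icc (-1 : ℝ) 1)ᶜ,
    ENNReal.ofReal (‖iteratedDeriv l r x‖ ^ 2 / |x| ^ 2)

/-! In the four terms below, `r` stands for `r_ε` and `ν` for the law of an observation `Y`. -/

noncomputable def termA1 (p : ℝ) (r : ℝ → ℂ) (ν : Measure ℝ) : ℝ≥0∞ :=
  supDeriv r 1 *
    ∫⁻ x in Ioi (0 : ℝ), ENNReal.ofReal (|x| ^ (p - 1)) * ν {y | x ≤ |y|} ^ (1 / 2 : ℝ)

noncomputable def termA2 (p : ℝ) (r : ℝ → ℂ) : ℝ≥0∞ :=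
  supDeriv r (leastGt (p + 1 / 2))

noncomputable def termA3 (p : ℝ) (r : ℝ → ℂ) (ν : Measure ℝ) (h : ℝ) : ℝ≥0∞ :=
  ((∫⁻ y, ENNReal.ofReal (|y| ^ (2 * p - 1 / 2)) ∂ν) * outerIntegral r h 0) ^ (1 / 2 : ℝ)

noncomputable def termA4 (p : ℝ) (r : ℝ → ℂ) (h : ℝ) : ℝ≥0∞ :=
  (∑ l ∈ Finset.range (leastGt (p - 1 / 2) + 1), outerIntegral r h l) ^ (1 / 2 : ℝ)

end WassersteinDeconvolution

/-!
On the real line the quantile coupling bounds `W_p^p` by `2^(p-1) p` times the distance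
`∫ |x|^(p-1) |F - G|`, and `μ` is at `W_p^p`-cost `h^p ∫ |x|^p k` from its convolution with the
rescaled kernel `k_h`. By the triangle inequality it remains to bound the weighted distance from
the preliminary estimator to the distribution function of `μ * k_h`. That estimator is an empirical
mean `n⁻¹ ∑ K (t - Y_j)` with expectation exactly this distribution function, so its risk is at most
`n^(-1/2) ∫ |x|^(p-1) (∫ |K (x - y) - c x|² ν(dy))^(1/2) dx` for any centring `c`, where `ν` is the
law of the observations. A smooth cutoff splits the Fourier transform of the density of `K` into
low and high frequencies. The low frequencies give a function whose density decays fast because the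
cutoff symbol is smooth, and centring at its limits at `±∞` leaves `A₁ + A₂`. At high frequencies
the primitive is taken by dividing the symbol by `-iv`, and Cauchy-Schwarz together with Plancherel
gives `A₃ + A₄`. Since `r_ε(0) = 1`, the term `A₂` is at least `1`, which absorbs the optimization
error `ρ`.
-/

namespace WassersteinDeconvolution

/-! ### Couplings on the real line -/

section Couplings

theorem setLIntegral_Ioc_abs_rpow {q : ℝ} (hq : -1 < q) {a b : ℝ} (ha : 0 ≤ a) (hab : a ≤ b) :
    ∫⁻ x in Ioc a b, ENNReal.ofReal (|x| ^ q) =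
      ENNReal.ofReal ((b ^ (q + 1) - a ^ (q + 1)) / (q + 1)) := by
  have hpos : EqOn (fun x : ℝ => ENNReal.ofReal (|x| ^ q)) (fun x => ENNReal.ofReal (x ^ q))
      (Ioc a b) := fun x hx => by simp only [abs_of_pos (ha.trans_lt hx.1)]
  rw [setLIntegral_congr_fun measurableSet_Ioc hpos, ← ofReal_integral_eq_lintegral_ofReal,
    ← intervalIntegral.integral_of_le hab, integral_rpow (Or.inl hq)]
  · exact (intervalIntegrable_iff_integrableOn_Ioc_of_le hab).1
      (intervalIntegral.intervalIntegrable_rpow' hq)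
  · filter_upwards [ae_restrict_mem measurableSet_Ioc] with x hx
    exact Real.rpow_nonneg (ha.trans hx.1.le) _

theorem setLIntegral_Ioc_comp_neg {f : ℝ → ℝ≥0∞} (hf : Measurable f) (a b : ℝ) :
    ∫⁻ x in Ioc a b, f (-x) = ∫⁻ x in Ioc (-b) (-a), f x := by
  have h := (Measure.measurePreserving_neg (volume : Measure ℝ)).setLIntegral_comp_preimage
    (s := Ioc (-b) (-a)) measurableSet_Ioc hf
  rw [← h, neg_preimage, Set.neg_Ioc, neg_neg, neg_neg]
  exact (setLIntegral_congr Ico_ae_eq_Ioc).symm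

theorem ofReal_add_rpow_le {p : ℝ} (hp : 1 ≤ p) {a b : ℝ} (ha : 0 ≤ a) (hb : 0 ≤ b) :
    ENNReal.ofReal ((a + b) ^ p) ≤
      ENNReal.ofReal (2 ^ (p - 1)) * (ENNReal.ofReal (a ^ p) + ENNReal.ofReal (b ^ p)) := by
  rw [← ENNReal.ofReal_add (by positivity) (by positivity), ← ENNReal.ofReal_mul (by positivity)]
  lift a to ℝ≥0 using ha
  lift b to ℝ≥0 using hb
  exact ENNReal.ofReal_le_ofReal (by exact_mod_cast NNReal.rpow_add_le_mul_rpow_add_rpow a b hp)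

theorem ofReal_sub_rpow_le_setLIntegral_of_nonneg {p : ℝ} (hp : 1 ≤ p) {a b : ℝ} (ha : 0 ≤ a)
    (hab : a ≤ b) :
    ENNReal.ofReal ((b - a) ^ p) ≤
      ENNReal.ofReal p * ∫⁻ x in Ioc a b, ENNReal.ofReal (|x| ^ (p - 1)) := by
  have hp0 : 0 < p := by linarith
  rw [setLIntegral_Ioc_abs_rpow (by linarith) ha hab, ← ENNReal.ofReal_mul hp0.le, sub_add_cancel,
    mul_div_cancel₀ _ hp0.ne']
  have h := Real.add_rpow_le_rpow_add (sub_nonneg.2 hab) ha hp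
  rw [sub_add_cancel] at h
  exact ENNReal.ofReal_le_ofReal (by linarith)

theorem ofReal_sub_rpow_le_setLIntegral {p : ℝ} (hp : 1 ≤ p) {a b : ℝ} (hab : a ≤ b) :
    ENNReal.ofReal ((b - a) ^ p) ≤
      ENNReal.ofReal (2 ^ (p - 1)) *
        (ENNReal.ofReal p * ∫⁻ x in Ioc a b, ENNReal.ofReal (|x| ^ (p - 1))) := by
  have hc : (1 : ℝ≥0∞) ≤ ENNReal.ofReal (2 ^ (p - 1)) :=
    ENNReal.one_le_ofReal.2 (Real.one_le_rpow one_le_two (by linarith))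
  have reflect : ∀ c d : ℝ, ∫⁻ x in Ioc c d, ENNReal.ofReal (|x| ^ (p - 1)) =
      ∫⁻ x in Ioc (-d) (-c), ENNReal.ofReal (|x| ^ (p - 1)) := fun c d => by
    simpa only [abs_neg] using
      setLIntegral_Ioc_comp_neg (f := fun x => ENNReal.ofReal (|x| ^ (p - 1))) (by fun_prop) c d
  rcases le_total 0 a with ha | ha
  · exact (ofReal_sub_rpow_le_setLIntegral_of_nonneg hp ha hab).trans (le_mul_of_one_le_left' hc)
  rcases le_total b 0 with hb | hb
  · have h := ofReal_sub_rpow_le_setLIntegral_of_nonneg hp (neg_nonneg.2 hb) (neg_le_neg hab)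
    rw [← reflect, neg_sub_neg] at h
    exact h.trans (le_mul_of_one_le_left' hc)
  · have hneg := ofReal_sub_rpow_le_setLIntegral_of_nonneg hp le_rfl (neg_nonneg.2 ha)
    have hpos := ofReal_sub_rpow_le_setLIntegral_of_nonneg hp le_rfl hb
    rw [← neg_zero, ← reflect, neg_zero, sub_zero] at hneg
    rw [sub_zero] at hpos
    rw [← Ioc_union_Ioc_eq_Ioc ha hb, lintegral_union measurableSet_Ioc
      (Ioc_disjoint_Ioc_of_le le_rfl), mul_add, sub_eq_neg_add]
    exact (ofReal_add_rpow_le hp (neg_nonneg.2 ha) hb).trans (by gcongr)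

theorem ofReal_abs_sub_rpow_le_setLIntegral {p : ℝ} (hp : 1 ≤ p) (a b : ℝ) :
    ENNReal.ofReal (|a - b| ^ p) ≤ ENNReal.ofReal (2 ^ (p - 1)) *
      (ENNReal.ofReal p * ∫⁻ x in Ico (min a b) (max a b), ENNReal.ofReal (|x| ^ (p - 1))) := by
  rw [← max_sub_min_eq_abs', restrict_Ico_eq_restrict_Ioc]
  exact ofReal_sub_rpow_le_setLIntegral hp min_le_max

/-- The quantile function (generalized inverse of the distribution function) of a measure on the
line. It is meaningful on `(0, 1)` only; elsewhere `sInf` may return its junk value `0`. -/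
noncomputable def quantile (μ : Measure ℝ) (u : ℝ) : ℝ := sInf {x | u ≤ cdf μ x}

theorem quantile_le_iff (μ : Measure ℝ) {u : ℝ} (hu : u ∈ Ioo (0 : ℝ) 1) (x : ℝ) :
    quantile μ u ≤ x ↔ u ≤ cdf μ x := by
  have hne : {x | u ≤ cdf μ x}.Nonempty :=
    (((tendsto_cdf_atTop μ).eventually (lt_mem_nhds hu.2)).exists).imp fun _ h => le_of_lt h
  have hbdd : BddBelow {x | u ≤ cdf μ x} := by
    obtain ⟨y, hy⟩ := ((tendsto_cdf_atBot μ).eventually (gt_mem_nhds hu.1)).exists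
    exact ⟨y, fun z hz => ((monotone_cdf μ).reflect_lt (hy.trans_le hz)).le⟩
  refine ⟨fun h => ?_, fun h => csInf_le hbdd h⟩
  have hgt : ∀ y, x < y → u ≤ cdf μ y := fun y hy => by
    obtain ⟨z, hz, hzy⟩ := exists_lt_of_csInf_lt hne (h.trans_lt hy)
    exact le_trans hz (monotone_cdf μ hzy.le)
  have hright : Filter.Tendsto (cdf μ) (nhdsWithin x (Ioi x)) (nhds (cdf μ x)) :=
    ((cdf μ).right_continuous x).tendsto.mono_left (nhdsWithin_mono _ Ioi_subset_Ici_self)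
  exact ge_of_tendsto hright (Filter.eventually_of_mem self_mem_nhdsWithin hgt)

theorem mem_Ico_quantile_iff (μ ν : Measure ℝ) {u : ℝ} (hu : u ∈ Ioo (0 : ℝ) 1) (x : ℝ) :
    x ∈ Ico (min (quantile μ u) (quantile ν u)) (max (quantile μ u) (quantile ν u)) ↔
      u ∈ uIoc (cdf μ x) (cdf ν x) := by
  rw [mem_Ico, ← not_le, min_le_iff, max_le_iff, uIoc, mem_Ioc, ← not_le, le_max_iff, le_min_iff,
    quantile_le_iff μ hu, quantile_le_iff ν hu, and_comm]

theorem aemeasurable_quantile (μ : Measure ℝ) :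
    AEMeasurable (quantile μ) (volume.restrict (Ioo (0 : ℝ) 1)) := by
  refine aemeasurable_restrict_of_monotoneOn measurableSet_Ioo fun u hu v hv huv => ?_
  rw [quantile_le_iff μ hu]
  exact huv.trans ((quantile_le_iff μ hv _).1 le_rfl)

theorem map_quantile (μ : Measure ℝ) [IsProbabilityMeasure μ] :
    (volume.restrict (Ioo (0 : ℝ) 1)).map (quantile μ) = μ := by
  refine Measure.ext_of_Iic _ _ fun x => ?_
  have hpre : quantile μ ⁻¹' Iic x ∩ Ioo 0 1 = Ioo 0 1 ∩ Iic (cdf μ x) := by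
    ext u
    simp only [mem_inter_iff, mem_preimage, mem_Iic, and_comm (b := u ≤ cdf μ x),
      and_congr_left_iff]
    exact fun hu => quantile_le_iff μ hu x
  have hae : (Ioo 0 1 ∩ Iic (cdf μ x) : Set ℝ) =ᵐ[volume] Ioc 0 (cdf μ x) := by
    have h : (Ioo 0 1 ∩ Iic (cdf μ x) : Set ℝ) =ᵐ[volume] (Ioc 0 1 ∩ Iic (cdf μ x) : Set ℝ) :=
      Ioo_ae_eq_Ioc.inter (ae_eq_refl _)
    rwa [Ioc_inter_Iic, min_eq_right (cdf_le_one μ x)] at h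
  rw [Measure.map_apply_of_aemeasurable (aemeasurable_quantile μ) measurableSet_Iic,
    Measure.restrict_apply' measurableSet_Ioo, hpre, measure_congr hae, Real.volume_Ioc, sub_zero,
    ofReal_cdf]

theorem lintegral_setLIntegral_quantile_le (μ ν : Measure ℝ) {f : ℝ → ℝ≥0∞} (hf : Measurable f) :
    ∫⁻ u in Ioo (0 : ℝ) 1, ∫⁻ x in Ico (min (quantile μ u) (quantile ν u))
        (max (quantile μ u) (quantile ν u)), f x ≤
      ∫⁻ x, f x * ENNReal.ofReal |cdf μ x - cdf ν x| := by
  have hmeas : Measurable fun z : ℝ × ℝ => (uIoc (cdf μ z.2) (cdf ν z.2)).indicator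
      (fun _ => f z.2) z.1 := by
    have hμ := (monotone_cdf μ).measurable
    have hν := (monotone_cdf ν).measurable
    exact Measurable.indicator (s := {z : ℝ × ℝ | z.1 ∈ uIoc (cdf μ z.2) (cdf ν z.2)})
      (f := fun z => f z.2) (by fun_prop)
      ((measurableSet_lt (by fun_prop) measurable_fst).inter
        (measurableSet_le measurable_fst (by fun_prop)))
  calc _ = ∫⁻ u in Ioo (0 : ℝ) 1, ∫⁻ x, (uIoc (cdf μ x) (cdf ν x)).indicator (fun _ => f x) u := by
        refine setLIntegral_congr_fun measurableSet_Ioo fun u hu => ?_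
        simp only [← lintegral_indicator measurableSet_Ico]
        classical
        exact lintegral_congr fun x => by
          simp only [indicator_apply]
          exact if_congr (mem_Ico_quantile_iff μ ν hu x) rfl rfl
    _ = ∫⁻ x, ∫⁻ u in Ioo (0 : ℝ) 1, (uIoc (cdf μ x) (cdf ν x)).indicator (fun _ => f x) u :=
        lintegral_lintegral_swap hmeas.aemeasurable
    _ ≤ ∫⁻ x, f x * ENNReal.ofReal |cdf μ x - cdf ν x| := by
        gcongr with x
        refine (setLIntegral_le_lintegral _ _).trans ?_
        rw [lintegral_indicator_const measurableSet_uIoc, Real.volume_uIoc, abs_sub_comm]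

/-- The coupling is the joint law of the two quantile functions under the uniform law. -/
theorem exists_coupling_lintegral_cost_le {p : ℝ} (hp : 1 ≤ p) (μ ν : Measure ℝ)
    [IsProbabilityMeasure μ] [IsProbabilityMeasure ν] :
    ∃ π : Measure (ℝ × ℝ), IsProbabilityMeasure π ∧ π.fst = μ ∧ π.snd = ν ∧
      ∫⁻ z, ENNReal.ofReal (|z.1 - z.2| ^ p) ∂π ≤
        ENNReal.ofReal (2 ^ (p - 1)) * (ENNReal.ofReal p * weightedDist p (cdf μ) (cdf ν)) := by
  have hμ := aemeasurable_quantile μ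
  have hν := aemeasurable_quantile ν
  have : IsProbabilityMeasure ((volume : Measure ℝ).restrict (Ioo 0 1)) := ⟨by simp⟩
  refine ⟨(volume.restrict (Ioo (0 : ℝ) 1)).map fun u => (quantile μ u, quantile ν u),
    Measure.isProbabilityMeasure_map (hμ.prodMk hν), ?_, ?_, ?_⟩
  · rw [Measure.fst_map_prodMk₀ hν, map_quantile]
  · rw [Measure.snd_map_prodMk₀ hμ, map_quantile]
  rw [lintegral_map' (by fun_prop) (hμ.prodMk hν)]
  refine (lintegral_mono fun u => ofReal_abs_sub_rpow_le_setLIntegral hp _ _).trans ?_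
  rw [lintegral_const_mul' _ _ ENNReal.ofReal_ne_top,
    lintegral_const_mul' _ _ ENNReal.ofReal_ne_top]
  gcongr
  refine (lintegral_setLIntegral_quantile_le μ ν (by fun_prop)).trans_eq ?_
  simp only [weightedDist, ENNReal.ofReal_mul (Real.rpow_nonneg (abs_nonneg _) _)]

theorem exists_gluing {α β δ : Type*} [MeasurableSpace α] [MeasurableSpace β] [MeasurableSpace δ]
    [StandardBorelSpace δ] [Nonempty δ] (π₁ : Measure (α × β)) (π₂ : Measure (β × δ))
    [IsProbabilityMeasure π₁] [IsFiniteMeasure π₂] (h : π₁.snd = π₂.fst) :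
    ∃ γ : Measure ((α × β) × δ), IsProbabilityMeasure γ ∧ γ.map Prod.fst = π₁ ∧
      γ.map (fun z => (z.1.2, z.2)) = π₂ := by
  set κ := π₂.condKernel
  refine ⟨π₁ ⊗ₘ (κ.comap Prod.snd measurable_snd), inferInstance, Measure.fst_compProd _ _, ?_⟩
  refine Measure.ext_of_lintegral _ fun f hf => ?_
  rw [lintegral_map hf (by fun_prop), Measure.lintegral_compProd (by fun_prop)]
  conv_rhs => rw [← Measure.disintegrate π₂ κ, Measure.lintegral_compProd hf, ← h, Measure.snd,
    lintegral_map hf.lintegral_kernel_prod_right' measurable_snd]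
  simp only [Kernel.comap_apply]

theorem wasserstein_rpow_le_lintegral_cost {p : ℝ} (hp : 0 < p) (π : Measure (ℝ × ℝ))
    [IsProbabilityMeasure π] :
    wasserstein p π.fst π.snd ^ p ≤ ∫⁻ z, ENNReal.ofReal (|z.1 - z.2| ^ p) ∂π := by
  have hle : wasserstein p π.fst π.snd ≤ (∫⁻ z, ENNReal.ofReal (|z.1 - z.2| ^ p) ∂π) ^ (1 / p) :=
    iInf₂_le π ⟨inferInstance, rfl, rfl⟩
  rwa [one_div, ENNReal.le_rpow_inv_iff hp] at hle

theorem wasserstein_rpow_le_add {p : ℝ} (hp : 1 ≤ p) (π₁ π₂ : Measure (ℝ × ℝ))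
    [IsProbabilityMeasure π₁] [IsProbabilityMeasure π₂] (h : π₁.snd = π₂.fst) :
    wasserstein p π₁.fst π₂.snd ^ p ≤ ENNReal.ofReal (2 ^ (p - 1)) *
      (∫⁻ z, ENNReal.ofReal (|z.1 - z.2| ^ p) ∂π₁ +
        ∫⁻ z, ENNReal.ofReal (|z.1 - z.2| ^ p) ∂π₂) := by
  obtain ⟨γ, hγ, h₁, h₂⟩ := exists_gluing π₁ π₂ h
  set π := γ.map fun z => (z.1.1, z.2)
  have : IsProbabilityMeasure π := Measure.isProbabilityMeasure_map (by fun_prop)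
  have hfst : π.fst = π₁.fst := by
    rw [Measure.fst_map_prodMk (by fun_prop), ← h₁, Measure.fst,
      Measure.map_map (by fun_prop) (by fun_prop)]
    rfl
  have hsnd : π.snd = π₂.snd := by
    rw [Measure.snd_map_prodMk (by fun_prop), ← h₂, Measure.snd,
      Measure.map_map (by fun_prop) (by fun_prop)]
    rfl
  rw [← hfst, ← hsnd]
  refine (wasserstein_rpow_le_lintegral_cost (by linarith) π).trans ?_
  rw [← h₁, ← h₂, lintegral_map (by fun_prop) (by fun_prop),
    lintegral_map (by fun_prop) (by fun_prop), lintegral_map (by fun_prop) (by fun_prop),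
    ← lintegral_add_left (by fun_prop), ← lintegral_const_mul' _ _ ENNReal.ofReal_ne_top]
  refine lintegral_mono fun z => le_trans ?_ (ofReal_add_rpow_le hp (abs_nonneg _) (abs_nonneg _))
  gcongr
  exact abs_sub_le _ _ _

theorem wasserstein_rpow_le_weightedDist_conv {p : ℝ} (hp : 1 ≤ p) (m μ ζ : Measure ℝ)
    [IsProbabilityMeasure m] [IsProbabilityMeasure μ] [IsProbabilityMeasure ζ] :
    wasserstein p m μ ^ p ≤ ENNReal.ofReal (2 ^ (p - 1)) *
      (ENNReal.ofReal (2 ^ (p - 1)) *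
          (ENNReal.ofReal p * weightedDist p (cdf m) (cdf (Measure.conv μ ζ)))
        + ∫⁻ z, ENNReal.ofReal (|z| ^ p) ∂ζ) := by
  obtain ⟨π₁, _, hfst₁, hsnd₁, hcost₁⟩ := exists_coupling_lintegral_cost_le hp m (Measure.conv μ ζ)
  set π₂ := (μ.prod ζ).map fun z => (z.1 + z.2, z.1) with hπ₂
  have : IsProbabilityMeasure π₂ := Measure.isProbabilityMeasure_map (by fun_prop)
  have hfst₂ : π₂.fst = Measure.conv μ ζ := by
    rw [hπ₂, Measure.fst_map_prodMk (by fun_prop)]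
    rfl
  have hsnd₂ : π₂.snd = μ := by
    rw [hπ₂, Measure.snd_map_prodMk (by fun_prop)]
    exact Measure.fst_prod
  have hcost₂ : ∫⁻ z, ENNReal.ofReal (|z.1 - z.2| ^ p) ∂π₂ =
      ∫⁻ z, ENNReal.ofReal (|z| ^ p) ∂ζ := by
    rw [hπ₂, lintegral_map (by fun_prop) (by fun_prop), lintegral_prod _ (by fun_prop)]
    simp
  have h := wasserstein_rpow_le_add hp π₁ π₂ (hsnd₁.trans hfst₂.symm)
  rw [hfst₁, hsnd₂, hcost₂] at h
  exact h.trans (by gcongr)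

end Couplings

/-! ### Fourier transforms and Plancherel's theorem -/

section Fourier

theorem lintegral_comp_div (f : ℝ → ℝ≥0∞) {c : ℝ} (hc : 0 < c) :
    ∫⁻ x, f (x / c) = ENNReal.ofReal c * ∫⁻ x, f x := by
  have hc' : c⁻¹ ≠ 0 := inv_ne_zero hc.ne'
  have h := (Homeomorph.mulRight₀ c⁻¹ hc').measurableEmbedding.lintegral_map (μ := volume) f
  rw [Homeomorph.coe_mulRight₀, Real.map_volume_mul_right hc', lintegral_smul_measure, inv_inv,
    abs_of_pos hc, smul_eq_mul] at h
  simpa only [div_eq_mul_inv] using h.symm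

theorem eLpNorm_two_sq {f : ℝ → ℂ} : eLpNorm f 2 volume ^ 2 = ∫⁻ x, ‖f x‖ₑ ^ 2 := by
  simpa using eLpNorm_nnreal_pow_eq_lintegral (p := 2) (f := f) (μ := volume) two_ne_zero

open scoped FourierTransform

theorem continuous_fourier {g : ℝ → ℂ} (hg : Integrable g) : Continuous (𝓕 g) :=
  VectorFourier.fourierIntegral_continuous Real.continuous_fourierChar (by exact continuous_inner)
    hg

open scoped SchwartzMap in
theorem fourier_ae_eq_fourier_toLp {g : ℝ → ℂ} (hg : Integrable g) (hg2 : MemLp g 2) :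
    𝓕 g =ᵐ[volume] (𝓕 (hg2.toLp g) : Lp ℂ 2 (volume : Measure ℝ)) := by
  refine ae_eq_of_integral_contDiff_smul_eq (continuous_fourier hg).locallyIntegrable
    ((Lp.memLp _).locallyIntegrable (by norm_num)) fun φ hφ hφc => ?_
  let ψ : 𝓢(ℝ, ℂ) := (hφc.comp_left (g := fun x : ℝ => (x : ℂ)) (by simp)).toSchwartzMap
    (Complex.ofRealCLM.contDiff.comp hφ)
  have hself_adjoint : ∫ x, (𝓕 (ψ : ℝ → ℂ)) x • g x = ∫ x, ψ x • (𝓕 g) x := by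
    have h := VectorFourier.integral_fourierIntegral_smul_eq_flip Real.continuous_fourierChar
      (L := innerₗ ℝ) (by exact continuous_inner) (ψ.integrable (μ := volume)) hg
    rwa [flip_innerₗ] at h
  have hdistribution := congrArg (fun T : 𝓢'(ℝ, ℂ) => T ψ)
    (Lp.fourier_toTemperedDistribution_eq (hg2.toLp g))
  simp only [TemperedDistribution.fourier_apply, Lp.toTemperedDistribution_apply]
    at hdistribution
  have hae : ∫ x, (𝓕 ψ) x • hg2.toLp g x = ∫ x, (𝓕 ψ) x • g x :=
    integral_congr_ae (by filter_upwards [hg2.coeFn_toLp] with x hx; rw [hx])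
  have hψ : ∀ x, ψ x = (φ x : ℂ) := fun _ => rfl
  rw [hae] at hdistribution
  simpa [hψ] using hself_adjoint.symm.trans hdistribution

theorem lintegral_enorm_sq_fourier {g : ℝ → ℂ} (hg : Integrable g) (hg2 : MemLp g 2) :
    ∫⁻ x, ‖𝓕 g x‖ₑ ^ 2 = ∫⁻ x, ‖g x‖ₑ ^ 2 := by
  rw [← eLpNorm_two_sq, ← eLpNorm_two_sq, eLpNorm_congr_ae (fourier_ae_eq_fourier_toLp hg hg2),
    ← eLpNorm_congr_ae hg2.coeFn_toLp, ← Lp.enorm_def, ← Lp.enorm_def, ← ofReal_norm,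
    ← ofReal_norm, Lp.norm_fourier_eq]

/-- The Fourier transform `x ↦ ∫ e^{-ivx} g(v) dv` in angular frequency, which is the convention
of the deconvolution formulas. -/
noncomputable def ft (g : ℝ → ℂ) (x : ℝ) : ℂ := 𝓕 g (x / (2 * Real.pi))

theorem ft_eq_integral (g : ℝ → ℂ) (x : ℝ) :
    ft g x = ∫ v : ℝ, Complex.exp (-(Complex.I * v * x)) * g v := by
  rw [ft, Real.fourier_real_eq_integral_exp_smul]
  congr with v
  rw [smul_eq_mul]
  congr 2
  push_cast
  have : (Real.pi : ℂ) ≠ 0 := by exact_mod_cast Real.pi_ne_zero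
  field_simp

theorem continuous_ft {g : ℝ → ℂ} (hg : Integrable g) : Continuous (ft g) :=
  (continuous_fourier hg).comp (by fun_prop)

theorem lintegral_enorm_sq_ft {g : ℝ → ℂ} (hg : Integrable g) (hg2 : MemLp g 2) :
    ∫⁻ x, ‖ft g x‖ₑ ^ 2 = ENNReal.ofReal (2 * Real.pi) * ∫⁻ x, ‖g x‖ₑ ^ 2 := by
  rw [← lintegral_enorm_sq_fourier hg hg2]
  exact lintegral_comp_div (fun x => ‖𝓕 g x‖ₑ ^ 2) (by positivity)

theorem ft_comp_add (g : ℝ → ℂ) (s x : ℝ) :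
    ft (fun v => g (v + s)) x = Complex.exp (Complex.I * s * x) * ft g x := by
  rw [ft_eq_integral, ft_eq_integral, ← integral_const_mul,
    ← integral_add_right_eq_self (fun v : ℝ => Complex.exp (Complex.I * s * x) *
      (Complex.exp (-(Complex.I * v * x)) * g v)) s]
  congr with v
  rw [← mul_assoc, ← Complex.exp_add]
  congr 2
  push_cast
  ring

theorem integrable_exp_mul {g : ℝ → ℂ} (hg : Integrable g) (x : ℝ) :
    Integrable fun v : ℝ => Complex.exp (-(Complex.I * v * x)) * g v :=
  hg.bdd_mul (c := 1) (by fun_prop) (Filter.Eventually.of_forall fun v => by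
    simp [Complex.norm_exp])

theorem ft_smul_sub {f g : ℝ → ℂ} (hf : Integrable f) (hg : Integrable g) (c : ℝ) (x : ℝ) :
    ft (fun v => c • (f v - g v)) x = c • (ft f x - ft g x) := by
  simp only [ft_eq_integral, mul_smul_comm, mul_sub]
  rw [integral_smul, integral_sub (integrable_exp_mul hf x) (integrable_exp_mul hg x)]

end Fourier

section LipschitzDeriv

theorem hasCompactSupport_of_eq_zero_outside {g : ℝ → ℂ} {a : ℝ} (hs : ∀ v, a < |v| → g v = 0) :
    HasCompactSupport g :=
  HasCompactSupport.intro (isCompact_Icc (a := -a) (b := a)) fun v hv =>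
    hs v (not_le.1 fun h => hv (abs_le.1 h))

theorem hasCompactSupport_iteratedDeriv {g : ℝ → ℂ} (hc : HasCompactSupport g) (m : ℕ) :
    HasCompactSupport (iteratedDeriv m g) := by
  induction m with
  | zero => rwa [iteratedDeriv_zero]
  | succ m ih => rw [iteratedDeriv_succ]; exact ih.deriv

theorem tendsto_exp_mul_sub_one_div (x : ℝ) :
    Filter.Tendsto (fun s : ℝ => s⁻¹ • (Complex.exp (Complex.I * s * x) - 1))
      (nhdsWithin 0 {0}ᶜ) (nhds (Complex.I * x)) := by
  have hlinear : HasDerivAt (fun s : ℝ => Complex.I * s * x) (Complex.I * x) 0 := by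
    simpa using ((Complex.ofRealCLM.hasDerivAt (x := (0 : ℝ))).const_mul Complex.I).mul_const
      (x : ℂ)
  simpa using hasDerivAt_iff_tendsto_slope_zero.1 hlinear.cexp

theorem norm_difference_quotient_le_indicator {g : ℝ → ℂ} {B : ℝ≥0} {a : ℝ}
    (hg : LipschitzWith B g) (hs : ∀ v, a < |v| → g v = 0) {t : ℝ} (ht : |t| < 1) (v : ℝ) :
    ‖t⁻¹ • (g (v + t) - g v)‖ ≤ (Icc (-(a + 1)) (a + 1)).indicator (fun _ => (B : ℝ)) v := by
  by_cases hv : v ∈ Icc (-(a + 1)) (a + 1)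
  · rw [indicator_of_mem hv, norm_smul, norm_inv, Real.norm_eq_abs]
    refine inv_mul_le_of_le_mul₀ (abs_nonneg t) B.2 ?_
    simpa [dist_eq_norm, mul_comm] using hg.dist_le_mul (v + t) v
  · have hv' : a + 1 < |v| := not_le.1 fun h => hv (abs_le.1 h)
    have hvt : a < |v + t| := by
      have : |v| - |t| ≤ |v + t| := by simpa using abs_sub_abs_le_abs_sub v (-t)
      linarith
    rw [indicator_of_notMem hv, hs _ hvt, hs v (by linarith), sub_zero, smul_zero, norm_zero]

/-- By Rademacher's theorem the difference quotients of `g` converge almost everywhere. -/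
theorem tendsto_ft_difference_quotient {g : ℝ → ℂ} {B : ℝ≥0} (hg : LipschitzWith B g)
    (hc : HasCompactSupport g) (x : ℝ) :
    Filter.Tendsto (fun t : ℝ => ft (fun v => t⁻¹ • (g (v + t) - g v)) x)
      (nhdsWithin 0 {0}ᶜ) (nhds (ft (deriv g) x)) := by
  have hcont := hg.continuous
  obtain ⟨a, ha⟩ := hc.isCompact.isBounded.subset_closedBall 0
  have hzero : ∀ v, a < |v| → g v = 0 := fun v hv => image_eq_zero_of_notMem_tsupport fun h =>
    hv.not_ge (by simpa using ha h)
  simp only [ft_eq_integral]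
  refine tendsto_integral_filter_of_dominated_convergence
    ((Icc (-(a + 1)) (a + 1)).indicator fun _ => (B : ℝ))
    (Filter.Eventually.of_forall fun t => by fun_prop) ?_
    ((integrable_indicator_iff measurableSet_Icc).2 (by simp)) ?_
  · filter_upwards [nhdsWithin_le_nhds (Metric.ball_mem_nhds (0 : ℝ) one_pos)] with t ht
    refine Filter.Eventually.of_forall fun v => ?_
    simpa [Complex.norm_exp] using
      norm_difference_quotient_le_indicator hg hzero (by simpa using ht) v
  · filter_upwards [hg.ae_differentiableAt] with v hv
    exact (hasDerivAt_iff_tendsto_slope_zero.1 hv.hasDerivAt).const_mul _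

theorem ft_deriv {g : ℝ → ℂ} {B : ℝ≥0} (hg : LipschitzWith B g) (hc : HasCompactSupport g)
    (x : ℝ) : ft (deriv g) x = Complex.I * x * ft g x := by
  have hint : Integrable g := hg.continuous.integrable_of_hasCompactSupport hc
  refine tendsto_nhds_unique (tendsto_ft_difference_quotient hg hc x)
    (((tendsto_exp_mul_sub_one_div x).mul_const (ft g x)).congr fun s => ?_)
  rw [ft_smul_sub (hint.comp_add_right s) hint, ft_comp_add, smul_mul_assoc, sub_mul, one_mul]

theorem ft_iteratedDeriv {g : ℝ → ℂ} {m : ℕ}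
    (hg : ∀ l < m, ∃ B : ℝ≥0, LipschitzWith B (iteratedDeriv l g)) (hc : HasCompactSupport g)
    (x : ℝ) : ft (iteratedDeriv m g) x = (Complex.I * x) ^ m * ft g x := by
  induction m with
  | zero => simp
  | succ m ih =>
    obtain ⟨B, hB⟩ := hg m m.lt_succ_self
    rw [iteratedDeriv_succ, ft_deriv hB (hasCompactSupport_iteratedDeriv hc m),
      ih fun l hl => hg l (hl.trans m.lt_succ_self), pow_succ']
    ring

theorem lintegral_pow_mul_enorm_sq_ft {g : ℝ → ℂ} {m : ℕ} {D : ℝ}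
    (hg : ∀ l < m, ∃ B : ℝ≥0, LipschitzWith B (iteratedDeriv l g)) (hc : HasCompactSupport g)
    (hm : AEStronglyMeasurable (iteratedDeriv m g)) (hD : ∀ v, ‖iteratedDeriv m g v‖ ≤ D) :
    ∫⁻ x, ENNReal.ofReal (|x| ^ (2 * m)) * ‖ft g x‖ₑ ^ 2 =
      ENNReal.ofReal (2 * Real.pi) * ∫⁻ x, ‖iteratedDeriv m g x‖ₑ ^ 2 := by
  have hLp (q : ℝ≥0∞) : MemLp (iteratedDeriv m g) q :=
    (hasCompactSupport_iteratedDeriv hc m).memLp_of_bound hm D (Filter.Eventually.of_forall hD)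
  rw [← lintegral_enorm_sq_ft (memLp_one_iff_integrable.1 (hLp 1)) (hLp 2)]
  refine lintegral_congr fun x => ?_
  rw [ft_iteratedDeriv hg hc, enorm_mul, mul_pow, ← ofReal_norm (_ ^ m), norm_pow, norm_mul,
    Complex.norm_I, one_mul, Complex.norm_real, Real.norm_eq_abs,
    ← ENNReal.ofReal_pow (by positivity), ← pow_mul, mul_comm m 2]

end LipschitzDeriv

/-! ### A Sobolev bound for Fourier transforms -/

section Sobolev

theorem iteratedDeriv_eq_zero_of_eq_zero_outside {g : ℝ → ℂ} {a : ℝ} (hs : ∀ v, a < |v| → g v = 0)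
    (m : ℕ) {v : ℝ} (hv : a < |v|) : iteratedDeriv m g v = 0 := by
  have he : g =ᶠ[nhds v] fun _ => 0 := by
    filter_upwards [(continuous_abs.tendsto v).eventually (lt_mem_nhds hv)] with u hu
    exact hs u hu
  rw [he.iteratedDeriv_eq]
  simp

theorem exists_lintegral_rpow_mul_le {q s : ℝ} (hq : 0 ≤ q) (hs : 2 * q + 1 < s) :
    ∃ C : ℝ≥0, ∀ f : ℝ → ℝ≥0∞, Measurable f →
      ∫⁻ x, ENNReal.ofReal (|x| ^ q) * f x ≤
        C * (∫⁻ x, ENNReal.ofReal ((1 + |x|) ^ s) * f x ^ 2) ^ (1 / 2 : ℝ) := by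
  have hfin : ∫⁻ x : ℝ, ENNReal.ofReal ((1 + ‖x‖) ^ (-(s - 2 * q))) < ∞ :=
    finite_integral_one_add_norm (by simp; linarith)
  set D := ∫⁻ x : ℝ, ENNReal.ofReal ((1 + ‖x‖) ^ (-(s - 2 * q)))
  refine ⟨(D ^ (1 / 2 : ℝ)).toNNReal, fun f hf => ?_⟩
  rw [ENNReal.coe_toNNReal (ENNReal.rpow_ne_top_of_nonneg (by norm_num) hfin.ne)]
  have hcauchy_schwarz := ENNReal.lintegral_mul_le_Lp_mul_Lq volume Real.HolderConjugate.two_two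
    (f := fun x : ℝ => ENNReal.ofReal ((1 + |x|) ^ (q - s / 2)))
    (g := fun x : ℝ => ENNReal.ofReal ((1 + |x|) ^ (s / 2)) * f x) (by fun_prop) (by fun_prop)
  refine le_trans (lintegral_mono fun x => ?_) (hcauchy_schwarz.trans (le_of_eq ?_))
  · simp only [Pi.mul_apply]
    rw [← mul_assoc, ← ENNReal.ofReal_mul (by positivity), ← Real.rpow_add (by positivity),
      sub_add_cancel]
    gcongr
    linarith
  · congr 2
    · refine lintegral_congr fun x => ?_
      rw [ENNReal.ofReal_rpow_of_nonneg (by positivity) (by norm_num),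
        ← Real.rpow_mul (by positivity), Real.norm_eq_abs]
      congr 2
      ring
    · refine lintegral_congr fun x => ?_
      rw [ENNReal.mul_rpow_of_nonneg _ _ (by norm_num),
        ENNReal.ofReal_rpow_of_nonneg (by positivity) (by norm_num),
        ← Real.rpow_mul (by positivity)]
      norm_num

theorem ofReal_one_add_abs_pow_le (m : ℕ) (x : ℝ) :
    ENNReal.ofReal ((1 + |x|) ^ m) ≤
      ENNReal.ofReal (2 ^ (m - 1)) * (1 + ENNReal.ofReal (|x| ^ m)) := by
  rw [← ENNReal.ofReal_one, ← ENNReal.ofReal_add (by norm_num) (by positivity),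
    ← ENNReal.ofReal_mul (by positivity)]
  simpa using ENNReal.ofReal_le_ofReal (add_pow_le zero_le_one (abs_nonneg x) m)

theorem exists_lintegral_rpow_mul_enorm_le {E : Type*} [NormedAddCommGroup E] [MeasurableSpace E]
    [OpensMeasurableSpace E] {q : ℝ} {m : ℕ} (hq : 0 ≤ q) (hm : q + 1 / 2 < m) :
    ∃ C : ℝ≥0, ∀ f : ℝ → E, Measurable f →
      ∫⁻ x, ENNReal.ofReal (|x| ^ q) * ‖f x‖ₑ ≤
        C * ((∫⁻ x, ‖f x‖ₑ ^ 2) + ∫⁻ x, ENNReal.ofReal (|x| ^ (2 * m)) * ‖f x‖ₑ ^ 2) ^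
          (1 / 2 : ℝ) := by
  obtain ⟨C, hC⟩ := exists_lintegral_rpow_mul_le (q := q) (s := (2 * m : ℕ)) hq
    (by push_cast; linarith)
  set K : ℝ≥0∞ := ENNReal.ofReal (2 ^ (2 * m - 1))
  have hK_root : K ^ (1 / 2 : ℝ) ≠ ∞ :=
    ENNReal.rpow_ne_top_of_nonneg (by norm_num) ENNReal.ofReal_ne_top
  refine ⟨C * (K ^ (1 / 2 : ℝ)).toNNReal, fun f hf => (hC _ hf.enorm).trans ?_⟩
  rw [ENNReal.coe_mul, ENNReal.coe_toNNReal hK_root, mul_assoc,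
    ← ENNReal.mul_rpow_of_nonneg _ _ (by norm_num), ← lintegral_add_left (by fun_prop),
    ← lintegral_const_mul' _ _ ENNReal.ofReal_ne_top]
  refine mul_le_mul_right (ENNReal.rpow_le_rpow (lintegral_mono fun x => ?_) (by norm_num)) _
  rw [Real.rpow_natCast, ← one_add_mul, ← mul_assoc]
  exact mul_le_mul_left (ofReal_one_add_abs_pow_le (2 * m) x) _

theorem lintegral_enorm_sq_le_of_bounded {f : ℝ → ℂ} {D : ℝ≥0} {a : ℝ} (hf : ∀ v, ‖f v‖ ≤ D)
    (hs : ∀ v, a < |v| → f v = 0) :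
    ∫⁻ v, ‖f v‖ₑ ^ 2 ≤ ENNReal.ofReal (2 * a) * (D : ℝ≥0∞) ^ 2 := by
  calc ∫⁻ x, ‖f x‖ₑ ^ 2 ≤ ∫⁻ x, (Icc (-a) a).indicator (fun _ => (D : ℝ≥0∞) ^ 2) x := by
        refine lintegral_mono fun x => ?_
        by_cases hx : x ∈ Icc (-a) a
        · rw [indicator_of_mem hx]
          gcongr
          exact enorm_le_coe.2 (by exact_mod_cast hf x)
        · rw [hs x (not_le.1 fun h => hx (abs_le.1 h))]
          simp
    _ = ENNReal.ofReal (2 * a) * (D : ℝ≥0∞) ^ 2 := by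
        rw [lintegral_indicator measurableSet_Icc, setLIntegral_const, Real.volume_Icc, mul_comm]
        ring_nf

theorem norm_iteratedDeriv_mul_le {𝕂 : Type*} [RCLike 𝕂] {f g : ℝ → 𝕂} {n : ℕ} {x A B : ℝ}
    (hf : ContDiffAt ℝ n f x) (hg : ContDiffAt ℝ n g x)
    (hA : ∀ i ≤ n, ‖iteratedDeriv i f x‖ ≤ A) (hB : ∀ i ≤ n, ‖iteratedDeriv i g x‖ ≤ B) :
    ‖iteratedDeriv n (fun v => f v * g v) x‖ ≤ 2 ^ n * (A * B) := by
  have hA0 : 0 ≤ A := (norm_nonneg _).trans (hA 0 (Nat.zero_le _))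
  rw [iteratedDeriv_fun_mul hf hg]
  calc _ ≤ ∑ i ∈ Finset.range (n + 1), (n.choose i : ℝ) * (A * B) := by
        refine norm_sum_le_of_le _ fun i hi => ?_
        rw [Finset.mem_range] at hi
        rw [mul_assoc, norm_mul, norm_mul, RCLike.norm_natCast]
        gcongr
        · exact hA i (by lia)
        · exact hB _ (by lia)
    _ = 2 ^ n * (A * B) := by
        rw [← Finset.sum_mul]
        exact_mod_cast congrArg (fun N : ℕ => (N : ℝ) * (A * B)) (Nat.sum_range_choose n)

theorem lipschitzWith_mul_of_bounded {f g : ℝ → ℂ} {A B : ℝ≥0} (hf : LipschitzWith A f)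
    (hg : LipschitzWith B g) (hfb : ∀ v, ‖f v‖ ≤ A) (hgb : ∀ v, ‖g v‖ ≤ B) :
    LipschitzWith (2 * (A * B)) fun v => f v * g v := by
  refine LipschitzWith.of_dist_le_mul fun x y => ?_
  have hfxy := hf.dist_le_mul x y
  have hgxy := hg.dist_le_mul x y
  rw [dist_eq_norm] at hfxy hgxy ⊢
  calc ‖f x * g x - f y * g y‖ = ‖f x * (g x - g y) + (f x - f y) * g y‖ := by ring_nf
    _ ≤ ‖f x‖ * ‖g x - g y‖ + ‖f x - f y‖ * ‖g y‖ := by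
        simpa only [norm_mul] using norm_add_le (f x * (g x - g y)) ((f x - f y) * g y)
    _ ≤ A * (B * dist x y) + (A * dist x y) * B := by
        gcongr
        · exact hfb x
        · exact hgb y
    _ = _ := by push_cast; ring

/-- The function `f` lies in the ball of radius `B` of the Hölder space `C^{m,1}`. -/
structure ContDiffLipWith (m : ℕ) (B : ℝ≥0) (f : ℝ → ℂ) : Prop where
  contDiff : ContDiff ℝ m f
  norm_le : ∀ l ≤ m, ∀ v, ‖iteratedDeriv l f v‖ ≤ B
  lipschitz : LipschitzWith B (iteratedDeriv m f)

namespace ContDiffLipWith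

variable {m : ℕ} {A B : ℝ≥0} {f g : ℝ → ℂ}

theorem of_norm_iteratedDeriv_le (hf : ContDiff ℝ (m + 1 : ℕ) f)
    (hB : ∀ l ≤ m + 1, ∀ v, ‖iteratedDeriv l f v‖ ≤ B) : ContDiffLipWith m B f where
  contDiff := hf.of_le (by exact_mod_cast m.le_succ)
  norm_le l hl := hB l (hl.trans m.le_succ)
  lipschitz := lipschitzWith_of_nnnorm_deriv_le
    (hf.differentiable_iteratedDeriv m (by exact_mod_cast m.lt_succ_self)) fun v => by
      rw [← iteratedDeriv_succ]
      exact hB (m + 1) le_rfl v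

theorem of_le (hf : ContDiffLipWith m B f) {l : ℕ} (hl : l ≤ m) : ContDiffLipWith l B f := by
  rcases hl.lt_or_eq with hl | rfl
  · exact of_norm_iteratedDeriv_le (hf.contDiff.of_le (by exact_mod_cast hl)) fun i hi =>
      hf.norm_le i (hi.trans hl)
  · exact hf

theorem lipschitz_of_le (hf : ContDiffLipWith m B f) {l : ℕ} (hl : l ≤ m) :
    LipschitzWith B (iteratedDeriv l f) :=
  (hf.of_le hl).lipschitz

theorem comp_mul_left (hf : ContDiffLipWith m B f) {c : ℝ} (hc : |c| ≤ 1) :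
    ContDiffLipWith m B fun v => f (c * v) := by
  have hderiv {l : ℕ} (hl : l ≤ m) : iteratedDeriv l (fun v => f (c * v)) =
      fun v => c ^ l • iteratedDeriv l f (c * v) :=
    iteratedDeriv_comp_const_smul (hf.contDiff.of_le (by exact_mod_cast hl)) c
  have hpow (l : ℕ) : ‖c ^ l‖ ≤ 1 := by
    rw [norm_pow, Real.norm_eq_abs]
    exact pow_le_one₀ (abs_nonneg c) hc
  refine ⟨hf.contDiff.comp (contDiff_const.mul contDiff_id), fun l hl v => ?_,
    LipschitzWith.of_dist_le_mul fun x y => ?_⟩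
  · rw [hderiv hl, norm_smul]
    exact (mul_le_of_le_one_left (norm_nonneg _) (hpow l)).trans (hf.norm_le l hl _)
  · have hcontract : dist (c * x) (c * y) ≤ dist x y := by
      rw [Real.dist_eq, Real.dist_eq, ← mul_sub, abs_mul]
      exact mul_le_of_le_one_left (abs_nonneg _) hc
    rw [hderiv le_rfl, dist_smul₀]
    calc _ ≤ 1 * (B * dist x y) := by
          gcongr
          · exact hpow m
          · exact (hf.lipschitz.dist_le_mul _ _).trans (by gcongr)
      _ = B * dist x y := one_mul _

theorem mul (hf : ContDiffLipWith m A f) (hg : ContDiffLipWith m B g) :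
    ContDiffLipWith m (2 ^ m * (2 * (A * B))) fun v => f v * g v := by
  refine ⟨hf.contDiff.mul hg.contDiff, fun l hl v => ?_, ?_⟩
  · have hcast : (l : WithTop ℕ∞) ≤ m := by exact_mod_cast hl
    refine (norm_iteratedDeriv_mul_le (hf.contDiff.of_le hcast).contDiffAt
      (hg.contDiff.of_le hcast).contDiffAt (fun i hi => hf.norm_le i (hi.trans hl) v)
      fun i hi => hg.norm_le i (hi.trans hl) v).trans ?_
    push_cast
    have hAB : (A : ℝ) * B ≤ 2 * (A * B) := by linarith [mul_nonneg A.coe_nonneg B.coe_nonneg]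
    exact mul_le_mul (pow_le_pow_right₀ one_le_two hl) hAB (by positivity) (by positivity)
  · have hleibniz (v : ℝ) := iteratedDeriv_fun_mul hf.contDiff.contDiffAt (x := v)
      hg.contDiff.contDiffAt
    refine LipschitzWith.of_dist_le_mul fun x y => ?_
    rw [dist_eq_norm, hleibniz, hleibniz, ← Finset.sum_sub_distrib]
    push_cast
    rw [show (2 : ℝ) ^ m = ∑ i ∈ Finset.range (m + 1), (m.choose i : ℝ) by
      exact_mod_cast (Nat.sum_range_choose m).symm, Finset.sum_mul, Finset.sum_mul]
    refine norm_sum_le_of_le _ fun i hi => ?_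
    have hi' : i ≤ m := Finset.mem_range_succ_iff.1 hi
    have hterm := (lipschitzWith_mul_of_bounded (hf.lipschitz_of_le hi')
      (hg.lipschitz_of_le (m.sub_le i)) (hf.norm_le i hi')
      (hg.norm_le _ (m.sub_le i))).dist_le_mul x y
    rw [dist_eq_norm] at hterm
    rw [mul_assoc, mul_assoc, ← mul_sub, norm_mul, Complex.norm_natCast, mul_assoc]
    gcongr
    exact_mod_cast hterm

end ContDiffLipWith

theorem exists_norm_iteratedDeriv_le_of_hasCompactSupport {f : ℝ → ℂ} {n : ℕ} (hf : ContDiff ℝ n f)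
    (hc : HasCompactSupport f) : ∃ C : ℝ≥0, ∀ l ≤ n, ∀ v, ‖iteratedDeriv l f v‖ ≤ C := by
  have hbounded (l : ℕ) (hl : l ≤ n) : ∃ C : ℝ, ∀ v, ‖iteratedDeriv l f v‖ ≤ C :=
    (hasCompactSupport_iteratedDeriv hc l).exists_bound_of_continuous
      (hf.continuous_iteratedDeriv l (by exact_mod_cast hl))
  choose! C hC using hbounded
  refine ⟨∑ l ∈ Finset.range (n + 1), (C l).toNNReal, fun l hl v =>
    (hC l hl v).trans ((Real.le_coe_toNNReal _).trans ?_)⟩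
  exact_mod_cast Finset.single_le_sum (f := fun l => (C l).toNNReal) (fun _ _ => zero_le)
    (Finset.mem_range_succ_iff.2 hl)

theorem exists_lintegral_rpow_mul_enorm_ft_le {q : ℝ} {m : ℕ} (hq : 0 ≤ q) (hm : q + 1 / 2 < m + 1)
    (a : ℝ) :
    ∃ C : ℝ≥0, ∀ (g : ℝ → ℂ) (D : ℝ≥0), ContDiffLipWith m D g → (∀ v, a < |v| → g v = 0) →
      ∫⁻ x, ENNReal.ofReal (|x| ^ q) * ‖ft g x‖ₑ ≤ C * D := by
  obtain ⟨C, hC⟩ := exists_lintegral_rpow_mul_enorm_le (E := ℂ) (m := m + 1) hq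
    (by exact_mod_cast hm)
  set K : ℝ≥0∞ := 2 * (ENNReal.ofReal (2 * Real.pi) * ENNReal.ofReal (2 * a))
  have hK : K ^ (1 / 2 : ℝ) ≠ ∞ := ENNReal.rpow_ne_top_of_nonneg (by norm_num)
    (ENNReal.mul_ne_top (by norm_num) (ENNReal.mul_ne_top ENNReal.ofReal_ne_top
      ENNReal.ofReal_ne_top))
  refine ⟨C * (K ^ (1 / 2 : ℝ)).toNNReal, fun g D hg hs => ?_⟩
  have hc := hasCompactSupport_of_eq_zero_outside hs
  have hint : Integrable g := hg.contDiff.continuous.integrable_of_hasCompactSupport hc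
  have hderiv_le : ∀ v, ‖iteratedDeriv (m + 1) g v‖ ≤ D := fun v => by
    rw [iteratedDeriv_succ]
    exact norm_deriv_le_of_lipschitz hg.lipschitz
  have hderiv_measurable : Measurable (iteratedDeriv (m + 1) g) := by
    rw [iteratedDeriv_succ]
    exact measurable_deriv _
  have hplancherel := lintegral_enorm_sq_ft hint
    (hg.contDiff.continuous.memLp_of_hasCompactSupport hc)
  have hplancherel_deriv := lintegral_pow_mul_enorm_sq_ft
    (fun l hl => ⟨D, hg.lipschitz_of_le (Nat.lt_succ_iff.1 hl)⟩) hc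
    hderiv_measurable.aestronglyMeasurable hderiv_le
  refine (hC _ (continuous_ft hint).measurable).trans ?_
  rw [hplancherel, hplancherel_deriv, ENNReal.coe_mul, ENNReal.coe_toNNReal hK, mul_assoc]
  gcongr
  have hsqrt : (D : ℝ≥0∞) = ((D : ℝ≥0∞) ^ 2) ^ (1 / 2 : ℝ) := by
    rw [← ENNReal.rpow_natCast, ← ENNReal.rpow_mul]
    norm_num
  rw [hsqrt, ← ENNReal.mul_rpow_of_nonneg _ _ (by norm_num), mul_assoc, mul_assoc,
    two_mul (_ * _)]
  refine ENNReal.rpow_le_rpow (add_le_add ?_ ?_) (by norm_num)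
  · gcongr
    exact lintegral_enorm_sq_le_of_bounded (fun v => by simpa using hg.norm_le 0 m.zero_le v) hs
  · gcongr
    exact lintegral_enorm_sq_le_of_bounded hderiv_le
      fun v => iteratedDeriv_eq_zero_of_eq_zero_outside hs (m + 1)

theorem integrable_ft {g : ℝ → ℂ} (hg : ContDiff ℝ 1 g) (hc : HasCompactSupport g) :
    Integrable (ft g) := by
  have hcont := continuous_ft (hg.continuous.integrable_of_hasCompactSupport hc)
  obtain ⟨a, ha⟩ := hc.isCompact.isBounded.subset_closedBall 0
  have hs : ∀ v, a < |v| → g v = 0 := fun v hv => image_eq_zero_of_notMem_tsupport fun h =>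
    hv.not_ge (by simpa using ha h)
  obtain ⟨B, hB⟩ := exists_norm_iteratedDeriv_le_of_hasCompactSupport (n := 1)
    (by exact_mod_cast hg) hc
  obtain ⟨C, hC⟩ := exists_lintegral_rpow_mul_enorm_ft_le (q := 0) (m := 0) le_rfl (by norm_num) a
  have hfinite := hC g B (.of_norm_iteratedDeriv_le (by exact_mod_cast hg) hB) hs
  simp only [Real.rpow_zero, ENNReal.ofReal_one, one_mul] at hfinite
  exact ⟨hcont.aestronglyMeasurable,
    hfinite.trans_lt (ENNReal.mul_lt_top ENNReal.coe_lt_top ENNReal.coe_lt_top)⟩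

end Sobolev

/-! ### Empirical means -/

section EmpiricalMeans

variable {Ω : Type*} [MeasurableSpace Ω] {P : Measure Ω}

theorem iIndepFun_prodMk [IsProbabilityMeasure P] {ι E F : Type*} [Finite ι] [MeasurableSpace E]
    [MeasurableSpace F] {X : ι → Ω → E} {ε : ι → Ω → F} (hX : ∀ i, AEMeasurable (X i) P)
    (hε : ∀ i, AEMeasurable (ε i) P) (iX : iIndepFun X P) (iε : iIndepFun ε P)
    (hXε : IndepFun (fun ω i => X i ω) (fun ω i => ε i ω) P) :
    iIndepFun (fun i ω => (X i ω, ε i ω)) P := by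
  have := Fintype.ofFinite ι
  have hXm : AEMeasurable (fun ω i => X i ω) P := aemeasurable_pi_lambda _ hX
  have hεm : AEMeasurable (fun ω i => ε i ω) P := aemeasurable_pi_lambda _ hε
  have : ∀ i, IsProbabilityMeasure (P.map (X i)) := fun i =>
    Measure.isProbabilityMeasure_map (hX i)
  have : ∀ i, IsProbabilityMeasure (P.map (ε i)) := fun i =>
    Measure.isProbabilityMeasure_map (hε i)
  have map_pair (i) : P.map (fun ω => (X i ω, ε i ω)) = (P.map (X i)).prod (P.map (ε i)) :=
    (indepFun_iff_map_prod_eq_prod_map_map (hX i) (hε i)).1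
      (hXε.comp (measurable_pi_apply i) (measurable_pi_apply i))
  have map_pairs : P.map (fun ω => (fun i => X i ω, fun i => ε i ω)) =
      (Measure.pi fun i => P.map (X i)).prod (Measure.pi fun i => P.map (ε i)) := by
    rw [(indepFun_iff_map_prod_eq_prod_map_map hXm hεm).1 hXε,
      (iIndepFun_iff_map_fun_eq_pi_map hX).1 iX, (iIndepFun_iff_map_fun_eq_pi_map hε).1 iε]
  have map_swap := (measurePreserving_arrowProdEquivProdArrow E F ι (fun i => P.map (X i))
    (fun i => P.map (ε i))).symm.map_eq
  rw [← map_pairs, AEMeasurable.map_map_of_aemeasurable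
    (MeasurableEquiv.measurable _).aemeasurable (hXm.prodMk hεm)] at map_swap
  rw [iIndepFun_iff_map_fun_eq_pi_map fun i => (hX i).prodMk (hε i)]
  simp_rw [map_pair]
  rw [← map_swap]
  rfl

theorem lintegral_le_lintegral_sq_rpow [IsProbabilityMeasure P] {f : Ω → ℝ≥0∞}
    (hf : AEMeasurable f P) :
    ∫⁻ ω, f ω ∂P ≤ (∫⁻ ω, f ω ^ 2 ∂P) ^ (1 / 2 : ℝ) := by
  simpa using ENNReal.lintegral_mul_le_Lp_mul_Lq P Real.HolderConjugate.two_two hf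
    (aemeasurable_const (b := (1 : ℝ≥0∞)))

theorem ofReal_variance_le_lintegral_sub_sq [IsProbabilityMeasure P] {f : Ω → ℝ}
    (hf : MemLp f 2 P) (c : ℝ) :
    ENNReal.ofReal Var[f; P] ≤ ∫⁻ ω, ENNReal.ofReal ((f ω - c) ^ 2) ∂P := by
  have hsub : MemLp (fun ω => f ω - c) 2 P := hf.sub (memLp_const c)
  rw [← variance_sub_const hf.aestronglyMeasurable c, ← ofReal_integral_eq_lintegral_ofReal
    hsub.integrable_sq (.of_forall fun _ => sq_nonneg _)]
  exact ENNReal.ofReal_le_ofReal (variance_le_expectation_sq hsub.aestronglyMeasurable)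

theorem ofReal_one_div_mul_rpow_half {n : ℕ} (hn : 1 ≤ n) (v : ℝ) :
    ENNReal.ofReal (1 / n) * ENNReal.ofReal (n * v) ^ (1 / 2 : ℝ) =
      ENNReal.ofReal ((n : ℝ) ^ (-(1 / 2) : ℝ)) * ENNReal.ofReal v ^ (1 / 2 : ℝ) := by
  have hn0 : (0 : ℝ) < n := by exact_mod_cast hn
  rw [ENNReal.ofReal_mul hn0.le, ENNReal.mul_rpow_of_nonneg _ _ (by norm_num), ← mul_assoc,
    ENNReal.ofReal_rpow_of_nonneg hn0.le (by norm_num), ← ENNReal.ofReal_mul (by positivity),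
    one_div, ← Real.rpow_neg_one, ← Real.rpow_add hn0]
  norm_num

variable {S : Type*} [MeasurableSpace S] {ν : Measure S} {n : ℕ} {Y : Fin n → Ω → S}

section

variable (hY : ∀ i, HasLaw (Y i) ν P) {f : S → ℝ} (hf : Measurable f) (hf2 : MemLp f 2 ν)
include hY hf hf2

theorem memLp_comp_of_hasLaw (j : Fin n) : MemLp (fun ω => f (Y j ω)) 2 P :=
  (memLp_map_measure_iff hf.aestronglyMeasurable (hY j).aemeasurable).1
    ((hY j).map_eq.symm ▸ hf2)

theorem integral_sum_comp [IsProbabilityMeasure P] :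
    ∫ ω, ∑ j, f (Y j ω) ∂P = n * ∫ y, f y ∂ν := by
  rw [integral_finsetSum _ fun j _ => (memLp_comp_of_hasLaw hY hf hf2 j).integrable one_le_two]
  have hmean (j) : ∫ ω, f (Y j ω) ∂P = ∫ y, f y ∂ν :=
    (hY j).integral_comp hf.aestronglyMeasurable
  simp [hmean]

theorem variance_sum_comp (hi : Pairwise fun i j => IndepFun (Y i) (Y j) P) :
    Var[fun ω => ∑ j, f (Y j ω); P] = n * Var[f; ν] := by
  have hvar (j) : Var[fun ω => f (Y j ω); P] = Var[f; ν] := by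
    rw [← (hY j).map_eq, variance_map hf.aemeasurable (hY j).aemeasurable]
    rfl
  rw [← Finset.sum_fn, IndepFun.variance_sum (fun j _ => memLp_comp_of_hasLaw hY hf hf2 j)
    fun i _ j _ hij => (hi hij).comp hf hf]
  simp [hvar]

theorem lintegral_abs_mean_sub_integral_le [IsProbabilityMeasure P] [IsProbabilityMeasure ν]
    (hn : 1 ≤ n) (hi : Pairwise fun i j => IndepFun (Y i) (Y j) P) (c : ℝ) :
    ∫⁻ ω, ENNReal.ofReal |1 / (n : ℝ) * ∑ j, f (Y j ω) - ∫ y, f y ∂ν| ∂P ≤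
      ENNReal.ofReal ((n : ℝ) ^ (-(1 / 2) : ℝ)) *
        (∫⁻ y, ENNReal.ofReal ((f y - c) ^ 2) ∂ν) ^ (1 / 2 : ℝ) := by
  have hn0 : (0 : ℝ) < n := by exact_mod_cast hn
  set s : Ω → ℝ := fun ω => ∑ j, f (Y j ω)
  have hs : MemLp s 2 P := memLp_finsetSum _ fun j _ => memLp_comp_of_hasLaw hY hf hf2 j
  calc ∫⁻ ω, ENNReal.ofReal |1 / (n : ℝ) * s ω - ∫ y, f y ∂ν| ∂P
      = ENNReal.ofReal (1 / n) * ∫⁻ ω, ‖s ω - ∫ ω, s ω ∂P‖ₑ ∂P := by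
        rw [← lintegral_const_mul' _ _ ENNReal.ofReal_ne_top]
        refine lintegral_congr fun ω => ?_
        rw [← ofReal_norm, ← ENNReal.ofReal_mul (by positivity), integral_sum_comp hY hf hf2,
          Real.norm_eq_abs, ← abs_of_pos (one_div_pos.2 hn0), ← abs_mul,
          abs_of_pos (one_div_pos.2 hn0), mul_sub, ← mul_assoc (1 / (n : ℝ)) n,
          one_div_mul_cancel hn0.ne', one_mul]
    _ ≤ ENNReal.ofReal (1 / n) * (∫⁻ ω, ‖s ω - ∫ ω, s ω ∂P‖ₑ ^ 2 ∂P) ^ (1 / 2 : ℝ) := by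
        gcongr
        exact lintegral_le_lintegral_sq_rpow (hs.aemeasurable.sub_const _).enorm
    _ = ENNReal.ofReal (1 / n) * ENNReal.ofReal (n * Var[f; ν]) ^ (1 / 2 : ℝ) := by
        rw [← variance_sum_comp hY hf hf2 hi, ofReal_variance hs, evariance]
    _ = ENNReal.ofReal ((n : ℝ) ^ (-(1 / 2) : ℝ)) * ENNReal.ofReal Var[f; ν] ^ (1 / 2 : ℝ) :=
        ofReal_one_div_mul_rpow_half hn _
    _ ≤ _ := by
        gcongr
        exact ofReal_variance_le_lintegral_sub_sq hf2 c

end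

end EmpiricalMeans

section WeightedStdDev

/-- The weighted integral `∫ |x|^{p-1} (∫ |K (x - y) - c x|² ν(dy))^{1/2} dx`, which controls the
fluctuations of empirical means of the functions `y ↦ K (x - y)`. The centering `c` need not be the
mean, and may be chosen to make the integral easy to estimate. -/
noncomputable def weightedStdDev (p : ℝ) (ν : Measure ℝ) (K c : ℝ → ℝ) : ℝ≥0∞ :=
  ∫⁻ x, ENNReal.ofReal (|x| ^ (p - 1)) *
    (∫⁻ y, ENNReal.ofReal ((K (x - y) - c x) ^ 2) ∂ν) ^ (1 / 2 : ℝ)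

variable {p : ℝ} {ν : Measure ℝ} [IsProbabilityMeasure ν]

theorem measurable_lintegral_sub_sq {K c : ℝ → ℝ} (hK : Measurable K) (hc : Measurable c) :
    Measurable fun x => ∫⁻ y, ENNReal.ofReal ((K (x - y) - c x) ^ 2) ∂ν :=
  Measurable.lintegral_prod_right'
    (f := fun z : ℝ × ℝ => ENNReal.ofReal ((K (z.1 - z.2) - c z.1) ^ 2)) (by fun_prop)

theorem weightedStdDev_add_le {K₁ K₂ c₁ c₂ : ℝ → ℝ} (hK₁ : Measurable K₁) (hc₁ : Measurable c₁)
    (hK₂ : Measurable K₂) :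
    weightedStdDev p ν (K₁ + K₂) (c₁ + c₂) ≤
      weightedStdDev p ν K₁ c₁ + weightedStdDev p ν K₂ c₂ := by
  have := measurable_lintegral_sub_sq (ν := ν) hK₁ hc₁
  rw [weightedStdDev, weightedStdDev, weightedStdDev, ← lintegral_add_left (by fun_prop)]
  refine lintegral_mono fun x => ?_
  rw [← mul_add]
  gcongr
  have minkowski := ENNReal.lintegral_Lp_add_le (μ := ν) (p := 2)
    (f := fun y => ‖K₁ (x - y) - c₁ x‖ₑ) (g := fun y => ‖K₂ (x - y) - c₂ x‖ₑ)
    (by fun_prop) (by fun_prop) one_le_two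
  have enorm_sq (a : ℝ) : ‖a‖ₑ ^ (2 : ℝ) = ENNReal.ofReal (a ^ 2) := by
    rw [← ofReal_norm, ENNReal.ofReal_rpow_of_nonneg (norm_nonneg _) zero_le_two,
      Real.rpow_two, Real.norm_eq_abs, sq_abs]
  simp only [enorm_sq] at minkowski
  refine le_trans ?_ minkowski
  gcongr with y
  rw [Pi.add_apply, ← enorm_sq, Pi.add_apply, Pi.add_apply, add_sub_add_comm]
  gcongr
  exact enorm_add_le _ _

theorem lintegral_weightedDist_mean_le {Ω : Type*} [MeasurableSpace Ω] {P : Measure Ω}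
    [IsProbabilityMeasure P] {n : ℕ} (hn : 1 ≤ n) {Y : Fin n → Ω → ℝ}
    (hY : ∀ i, HasLaw (Y i) ν P) (hi : Pairwise fun i j => IndepFun (Y i) (Y j) P) {K : ℝ → ℝ}
    (hK : Measurable K) {b : ℝ} (hb : ∀ x, |K x| ≤ b) (c : ℝ → ℝ) :
    ∫⁻ ω, weightedDist p (fun x => 1 / n * ∑ j, K (x - Y j ω)) (fun x => ∫ y, K (x - y) ∂ν) ∂P ≤
      ENNReal.ofReal ((n : ℝ) ^ (-(1 / 2) : ℝ)) * weightedStdDev p ν K c := by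
  have joint_measurable : AEMeasurable (fun z : Ω × ℝ => ENNReal.ofReal (|z.2| ^ (p - 1) *
      |1 / n * ∑ j, K (z.2 - Y j z.1) - ∫ y, K (z.2 - y) ∂ν|)) (P.prod volume) := by
    have hsum : AEMeasurable (fun z : Ω × ℝ => ∑ j, K (z.2 - Y j z.1)) (P.prod volume) :=
      Finset.aemeasurable_fun_sum _ fun j _ => hK.comp_aemeasurable
        (measurable_snd.aemeasurable.sub (hY j).aemeasurable.comp_fst)
    have hmean : Measurable fun x => ∫ y, K (x - y) ∂ν :=
      (StronglyMeasurable.integral_prod_right' (f := fun z : ℝ × ℝ => K (z.1 - z.2))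
        (by fun_prop : Measurable _).stronglyMeasurable).measurable
    have hmean' : AEMeasurable (fun z : Ω × ℝ => ∫ y, K (z.2 - y) ∂ν) (P.prod volume) :=
      (hmean.comp measurable_snd).aemeasurable
    have hweight : AEMeasurable (fun z : Ω × ℝ => |z.2| ^ (p - 1)) (P.prod volume) := by fun_prop
    exact (hweight.mul ((hsum.const_mul _).sub hmean').abs).ennreal_ofReal
  simp only [weightedDist, weightedStdDev]
  rw [lintegral_lintegral_swap joint_measurable, ← lintegral_const_mul' _ _ ENNReal.ofReal_ne_top]
  refine lintegral_mono fun x => ?_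
  simp only [ENNReal.ofReal_mul (show 0 ≤ |x| ^ (p - 1) by positivity)]
  rw [lintegral_const_mul' _ _ ENNReal.ofReal_ne_top, mul_left_comm]
  have hKx : Measurable fun y => K (x - y) := by fun_prop
  gcongr
  exact lintegral_abs_mean_sub_integral_le hY hKx
    (MemLp.of_bound hKx.aestronglyMeasurable b (.of_forall fun y => hb _)) hn hi (c x)

end WeightedStdDev

/-! ### Convolutions with signed densities -/

section SignedDensity

variable {S : Type*} [MeasurableSpace S] {μ : Measure S} {a : S → ℝ}

theorem integral_withDensity_ofReal (ha : AEMeasurable a μ) (F : S → ℂ) :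
    ∫ x, F x ∂(μ.withDensity fun x => ENNReal.ofReal (a x)) =
      ∫ x, F x * (max (a x) 0 : ℝ) ∂μ := by
  rw [integral_withDensity_eq_integral_toReal_smul₀ ha.ennreal_ofReal
    (.of_forall fun x => ENNReal.ofReal_lt_top)]
  simp only [ENNReal.toReal_ofReal', Complex.real_smul, mul_comm]

theorem integral_mul_ofReal_eq_integral_withDensity_sub (ha : Integrable a μ) {F : S → ℂ}
    (hF : AEStronglyMeasurable F μ) {b : ℝ} (hb : ∀ x, ‖F x‖ ≤ b) :
    ∫ x, F x * a x ∂μ = ∫ x, F x ∂(μ.withDensity fun x => ENNReal.ofReal (a x)) -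
      ∫ x, F x ∂(μ.withDensity fun x => ENNReal.ofReal (-a x)) := by
  have integrable_pos (c : S → ℝ) (hc : Integrable c μ) :
      Integrable (fun x => F x * (max (c x) 0 : ℝ)) μ :=
    hc.pos_part.ofReal.bdd_mul hF (.of_forall hb)
  rw [integral_withDensity_ofReal ha.aemeasurable,
    integral_withDensity_ofReal (a := fun x => -a x) ha.aemeasurable.neg,
    ← integral_sub (integrable_pos a ha) (integrable_pos (fun x => -a x) ha.neg)]
  refine integral_congr_ae (.of_forall fun x => ?_)
  simp only
  rw [← mul_sub, ← Complex.ofReal_sub, max_zero_sub_max_neg_zero_eq_self]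

end SignedDensity

section ConvolutionEquation

theorem charFun_add (μ ν : Measure ℝ) [IsFiniteMeasure μ] [IsFiniteMeasure ν] :
    charFun (μ + ν) = charFun μ + charFun ν := by
  have hint (m : Measure ℝ) [IsFiniteMeasure m] (t : ℝ) :
      Integrable (fun x : ℝ => Complex.exp (t * x * Complex.I)) m :=
    .of_bound (by fun_prop) 1 (.of_forall fun x => by rw [Complex.norm_exp]; simp)
  ext t
  simp only [charFun_apply_real, Pi.add_apply]
  exact integral_add_measure (hint μ t) (hint ν t)

theorem conv_apply_Iic (ν γ : Measure ℝ) [SFinite γ] (t : ℝ) :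
    (Measure.conv ν γ) (Iic t) = ∫⁻ y, γ (Iic (t - y)) ∂ν := by
  rw [← lintegral_indicator_one measurableSet_Iic,
    Measure.lintegral_conv (measurable_one.indicator measurableSet_Iic)]
  refine lintegral_congr fun y => ?_
  rw [← lintegral_indicator_one measurableSet_Iic]
  refine lintegral_congr fun x => ?_
  simp only [indicator, mem_Iic, le_sub_iff_add_le', Pi.one_apply]

theorem measurable_measure_Iic_sub (γ : Measure ℝ) (t : ℝ) :
    Measurable fun y => γ (Iic (t - y)) :=
  Antitone.measurable fun y z hyz => measure_mono (Iic_subset_Iic.2 (by linarith))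

theorem integrable_measureReal_Iic_sub (ν γ : Measure ℝ) [IsFiniteMeasure ν] [IsFiniteMeasure γ]
    (t : ℝ) : Integrable (fun y => γ.real (Iic (t - y))) ν := by
  refine .of_bound (measurable_measure_Iic_sub γ t).ennreal_toReal.aestronglyMeasurable
    (γ.real univ) (.of_forall fun y => ?_)
  rw [Real.norm_of_nonneg measureReal_nonneg]
  exact measureReal_mono (subset_univ _)

theorem integral_measureReal_Iic_sub (ν γ : Measure ℝ) [IsFiniteMeasure γ] (t : ℝ) :
    ∫ y, γ.real (Iic (t - y)) ∂ν = (Measure.conv ν γ).real (Iic t) := by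
  rw [measureReal_def, conv_apply_Iic]
  exact integral_toReal (measurable_measure_Iic_sub γ t).aemeasurable
    (.of_forall fun y => measure_lt_top _ _)

variable {a : ℝ → ℝ} {ν M : Measure ℝ} [IsFiniteMeasure ν] [IsFiniteMeasure M]

theorem conv_withDensity_eq_add_of_charFun (ha : Integrable a)
    (h : ∀ t : ℝ, (∫ x : ℝ, Complex.exp (t * x * Complex.I) * a x) * charFun ν t = charFun M t) :
    Measure.conv ν (volume.withDensity fun x => ENNReal.ofReal (a x)) =
      Measure.conv ν (volume.withDensity fun x => ENNReal.ofReal (-a x)) + M := by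
  have := isFiniteMeasure_withDensity_ofReal ha.2
  have := isFiniteMeasure_withDensity_ofReal (f := fun x => -a x) ha.neg.2
  refine Measure.ext_of_charFun (funext fun t => ?_)
  rw [charFun_add, Pi.add_apply, charFun_conv, charFun_conv, ← h t,
    integral_mul_ofReal_eq_integral_withDensity_sub ha (by fun_prop) (b := 1)
      fun x => by rw [Complex.norm_exp]; simp]
  simp only [charFun_apply_real]
  ring

-- The density `a` may change sign, so the uniqueness theorem for characteristic functions is
-- applied after the negative part of `a` has been moved to the other side.
theorem integral_setIntegral_Iic_sub_eq (ha : Integrable a)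
    (h : ∀ t : ℝ, (∫ x : ℝ, Complex.exp (t * x * Complex.I) * a x) * charFun ν t = charFun M t)
    (t : ℝ) :
    ∫ y, (∫ u in Iic (t - y), a u) ∂ν = M.real (Iic t) := by
  set α := volume.withDensity fun x => ENNReal.ofReal (a x) with hα
  set β := volume.withDensity fun x => ENNReal.ofReal (-a x) with hβ
  have : IsFiniteMeasure α := isFiniteMeasure_withDensity_ofReal ha.2
  have : IsFiniteMeasure β := isFiniteMeasure_withDensity_ofReal ha.neg.2
  have setIntegral_eq (s) : ∫ u in Iic s, a u = α.real (Iic s) - β.real (Iic s) := by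
    rw [integral_eq_lintegral_pos_part_sub_lintegral_neg_part ha.integrableOn, measureReal_def,
      measureReal_def, hα, hβ, withDensity_apply _ measurableSet_Iic,
      withDensity_apply _ measurableSet_Iic]
  simp_rw [setIntegral_eq]
  rw [integral_sub (integrable_measureReal_Iic_sub ν α t) (integrable_measureReal_Iic_sub ν β t),
    integral_measureReal_Iic_sub, integral_measureReal_Iic_sub,
    conv_withDensity_eq_add_of_charFun ha h, measureReal_add_apply]
  ring

end ConvolutionEquation

/-! ### Frequency cutoffs -/

section Cutoffs

theorem norm_iteratedDeriv_ofReal {f : ℝ → ℝ} {n : ℕ} {x : ℝ} (hf : ContDiffAt ℝ n f x) :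
    ‖iteratedDeriv n (fun v => (f v : ℂ)) x‖ = ‖iteratedDeriv n f x‖ := by
  have h := Complex.ofRealLI.norm_iteratedFDeriv_comp_left hf (i := n) le_rfl
  rwa [norm_iteratedFDeriv_eq_norm_iteratedDeriv, norm_iteratedFDeriv_eq_norm_iteratedDeriv] at h

theorem norm_iteratedDeriv_inv_le {n l : ℕ} (hl : l ≤ n) {v : ℝ} (hv : 1 < |v|) :
    ‖iteratedDeriv l (fun v : ℝ => v⁻¹) v‖ ≤ n.factorial / |v| := by
  have iteratedDeriv_inv :
      iteratedDeriv l (fun v : ℝ => v⁻¹) v = (-1) ^ l * l.factorial * v ^ (-1 - l : ℤ) := by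
    rw [iteratedDeriv_eq_iterate]
    exact iter_deriv_inv l v
  rw [iteratedDeriv_inv, norm_mul, norm_mul, norm_pow, norm_neg, norm_one, one_pow, one_mul,
    norm_zpow, Real.norm_eq_abs, Real.norm_eq_abs, Nat.abs_cast, div_eq_mul_inv]
  gcongr
  rw [← zpow_neg_one]
  exact zpow_le_zpow_right₀ hv.le (by omega)

/-- A smooth function equal to one on `[-1, 1]` and vanishing outside `[-2, 2]`. -/
noncomputable def cutoff : ContDiffBump (0 : ℝ) := ⟨1, 2, one_pos, one_lt_two⟩

/-- The cutoff to low frequencies, with complex values. -/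
noncomputable def lowCut (v : ℝ) : ℂ := (cutoff v : ℝ)

/-- The complementary cutoff to high frequencies, divided by `-iv`: multiplying a Fourier transform
by this function restricts it to high frequencies and passes to a primitive. -/
noncomputable def highCut (v : ℝ) : ℂ := Complex.I * ((1 - lowCut v) * (v⁻¹ : ℝ))

theorem lowCut_eq_one {v : ℝ} (hv : |v| ≤ 1) : lowCut v = 1 := by
  rw [lowCut, cutoff.one_of_mem_closedBall (by simpa [cutoff] using hv), Complex.ofReal_one]

theorem lowCut_eq_zero {v : ℝ} (hv : 2 < |v|) : lowCut v = 0 := by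
  rw [lowCut, cutoff.zero_of_le_dist (by simpa [cutoff] using hv.le), Complex.ofReal_zero]

theorem highCut_eq_zero {v : ℝ} (hv : |v| ≤ 1) : highCut v = 0 := by
  rw [highCut, lowCut_eq_one hv, sub_self, zero_mul, mul_zero]

theorem neg_I_mul_highCut (v : ℝ) : -Complex.I * v * highCut v = 1 - lowCut v := by
  rcases eq_or_ne v 0 with rfl | hv
  · rw [lowCut_eq_one (by simp)]
    simp
  · have hv' : (v : ℂ) ≠ 0 := by exact_mod_cast hv
    rw [highCut, Complex.ofReal_inv]
    field_simp
    rw [Complex.I_sq]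
    ring

theorem contDiff_lowCut (n : ℕ) : ContDiff ℝ n lowCut :=
  Complex.ofRealCLM.contDiff.comp (cutoff.contDiff.of_le (by exact_mod_cast le_top))

theorem contDiffAt_ofReal_inv {v : ℝ} (hv : v ≠ 0) (n : ℕ) :
    ContDiffAt ℝ n (fun v : ℝ => ((v⁻¹ : ℝ) : ℂ)) v :=
  Complex.ofRealCLM.contDiff.contDiffAt.comp v (contDiffAt_inv ℝ hv)

theorem contDiff_highCut (n : ℕ) : ContDiff ℝ n highCut := by
  refine contDiff_iff_contDiffAt.2 fun v => ?_
  rcases eq_or_ne v 0 with rfl | hv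
  · have eventually_zero : highCut =ᶠ[nhds 0] fun _ => 0 := by
      filter_upwards [Metric.closedBall_mem_nhds (0 : ℝ) one_pos] with u hu
      exact highCut_eq_zero (by simpa using hu)
    exact contDiffAt_const.congr_of_eventuallyEq eventually_zero
  · exact contDiffAt_const.mul
      ((contDiffAt_const.sub (contDiff_lowCut n).contDiffAt).mul (contDiffAt_ofReal_inv hv n))

theorem exists_norm_iteratedDeriv_lowCut_le (n : ℕ) :
    ∃ C : ℝ≥0, ∀ l ≤ n, ∀ v, ‖iteratedDeriv l lowCut v‖ ≤ C :=
  exists_norm_iteratedDeriv_le_of_hasCompactSupport (contDiff_lowCut n)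
    (hasCompactSupport_of_eq_zero_outside fun _ hv => lowCut_eq_zero hv)

theorem norm_iteratedDeriv_one_sub_le {f : ℝ → ℂ} {l : ℕ} {v C : ℝ}
    (hC : ‖iteratedDeriv l f v‖ ≤ C) : ‖iteratedDeriv l (fun v => 1 - f v) v‖ ≤ 1 + C := by
  rcases Nat.eq_zero_or_pos l with rfl | hl
  · simp only [iteratedDeriv_zero] at hC ⊢
    calc ‖1 - f v‖ ≤ ‖(1 : ℂ)‖ + ‖f v‖ := norm_sub_le _ _
      _ ≤ 1 + C := by rw [norm_one]; gcongr
  · rw [iteratedDeriv_const_sub hl, iteratedDeriv_neg, norm_neg]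
    linarith

theorem exists_norm_iteratedDeriv_highCut_le (n : ℕ) :
    ∃ C : ℝ≥0, ∀ l ≤ n, ∀ v, 1 < |v| → ‖iteratedDeriv l highCut v‖ ≤ C / |v| := by
  obtain ⟨C, hC⟩ := exists_norm_iteratedDeriv_lowCut_le n
  refine ⟨2 ^ n * ((1 + C) * n.factorial), fun l hl v hv => ?_⟩
  have hv0 : v ≠ 0 := abs_pos.1 (one_pos.trans hv)
  have inv_le (i : ℕ) (hi : i ≤ l) :
      ‖iteratedDeriv i (fun v : ℝ => ((v⁻¹ : ℝ) : ℂ)) v‖ ≤ n.factorial / |v| := by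
    rw [norm_iteratedDeriv_ofReal (contDiffAt_inv ℝ hv0)]
    exact norm_iteratedDeriv_inv_le (hi.trans hl) hv
  have leibniz := norm_iteratedDeriv_mul_le
    (contDiffAt_const.sub (contDiff_lowCut l).contDiffAt) (contDiffAt_ofReal_inv hv0 l)
    (fun i hi => norm_iteratedDeriv_one_sub_le (hC i (hi.trans hl) v)) inv_le
  have pull_I : iteratedDeriv l highCut v =
      Complex.I * iteratedDeriv l (fun v => (1 - lowCut v) * (v⁻¹ : ℝ)) v :=
    iteratedDeriv_const_mul_field _ _
  rw [pull_I, norm_mul, Complex.norm_I, one_mul]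
  refine leibniz.trans ?_
  push_cast
  rw [mul_div_assoc, mul_div_assoc]
  gcongr
  norm_num

end Cutoffs

/-! ### Symbols of the low and high frequency parts -/

section Symbols

variable {p : ℝ} {k : ℝ → ℝ} {r : ℝ → ℂ} {h v : ℝ}

/-- The Fourier transform of the kernel at bandwidth `h`, evaluated at `-v`. -/
noncomputable def scaledStar (k : ℝ → ℝ) (h v : ℝ) : ℂ := fourierStar k (-h * v)

/-- The Fourier transform of the summands of the estimator, where `r` stands for `recipChar με`. -/
noncomputable def symbol (k : ℝ → ℝ) (r : ℝ → ℂ) (h v : ℝ) : ℂ := scaledStar k h v * r v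

/-- The low frequency part of `symbol k r h`. -/
noncomputable def lowSymbol (k : ℝ → ℝ) (r : ℝ → ℂ) (h v : ℝ) : ℂ :=
  scaledStar k h v * (r v * lowCut v)

/-- The symbol of a primitive of the high frequency part of `symbol k r h`. -/
noncomputable def highSymbol (k : ℝ → ℝ) (r : ℝ → ℂ) (h v : ℝ) : ℂ :=
  scaledStar k h v * (r v * highCut v)

theorem IsKernel.exists_contDiffLipWith (hk : IsKernel p k) :
    ∃ M, ContDiffLipWith ⌈p⌉₊ M (fourierStar k) := by
  obtain ⟨C, hC⟩ := exists_norm_iteratedDeriv_le_of_hasCompactSupport hk.contDiff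
    (hasCompactSupport_of_eq_zero_outside hk.support)
  obtain ⟨L, hL⟩ := hk.lipschitz
  exact ⟨C + L, hk.contDiff, fun l hl v => (hC l hl v).trans (by simp), hL.weaken le_add_self⟩

theorem IsKernel.exists_contDiffLipWith_scaledStar (hk : IsKernel p k) :
    ∃ M, ∀ h, 0 < h → h ≤ 1 → ContDiffLipWith ⌈p⌉₊ M (scaledStar k h) := by
  obtain ⟨M, hM⟩ := hk.exists_contDiffLipWith
  exact ⟨M, fun h hh hh1 => hM.comp_mul_left (by rwa [abs_neg, abs_of_pos hh])⟩

theorem IsKernel.scaledStar_eq_zero (hk : IsKernel p k) (hh : 0 < h) (hv : 1 / h < |v|) :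
    scaledStar k h v = 0 := by
  refine hk.support _ ?_
  rwa [abs_mul, abs_neg, abs_of_pos hh, ← div_lt_iff₀' hh]

theorem IsKernel.contDiff_scaledStar (hk : IsKernel p k) (h : ℝ) {m : ℕ} (hm : m ≤ ⌈p⌉₊) :
    ContDiff ℝ m (scaledStar k h) :=
  (hk.contDiff.of_le (by exact_mod_cast hm)).comp (contDiff_const.mul contDiff_id)

theorem IsKernel.symbol_eq_zero (hk : IsKernel p k) (r : ℝ → ℂ) (hh : 0 < h)
    (hv : 1 / h < |v|) : symbol k r h v = 0 := by
  rw [symbol, hk.scaledStar_eq_zero hh hv, zero_mul]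

theorem lowSymbol_eq_zero (k : ℝ → ℝ) (r : ℝ → ℂ) (h : ℝ) (hv : 2 < |v|) :
    lowSymbol k r h v = 0 := by
  rw [lowSymbol, lowCut_eq_zero hv, mul_zero, mul_zero]

theorem highSymbol_eq_zero_of_abs_le_one (k : ℝ → ℝ) (r : ℝ → ℂ) (h : ℝ) (hv : |v| ≤ 1) :
    highSymbol k r h v = 0 := by
  rw [highSymbol, highCut_eq_zero hv, mul_zero, mul_zero]

theorem IsKernel.highSymbol_eq_zero (hk : IsKernel p k) (r : ℝ → ℂ) (hh : 0 < h)
    (hv : 1 / h < |v|) : highSymbol k r h v = 0 := by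
  rw [highSymbol, hk.scaledStar_eq_zero hh hv, zero_mul]

theorem IsKernel.contDiff_symbol (hk : IsKernel p k) {m : ℕ} (hm : m ≤ ⌈p⌉₊)
    (hr : ContDiff ℝ m r) (h : ℝ) : ContDiff ℝ m (symbol k r h) :=
  (hk.contDiff_scaledStar h hm).mul hr

theorem IsKernel.contDiff_lowSymbol (hk : IsKernel p k) {m : ℕ} (hm : m ≤ ⌈p⌉₊)
    (hr : ContDiff ℝ m r) (h : ℝ) : ContDiff ℝ m (lowSymbol k r h) :=
  (hk.contDiff_scaledStar h hm).mul (hr.mul (contDiff_lowCut m))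

theorem IsKernel.contDiff_highSymbol (hk : IsKernel p k) {m : ℕ} (hm : m ≤ ⌈p⌉₊)
    (hr : ContDiff ℝ m r) (h : ℝ) : ContDiff ℝ m (highSymbol k r h) :=
  (hk.contDiff_scaledStar h hm).mul (hr.mul (contDiff_highCut m))

theorem exists_norm_iteratedDeriv_mul_lowCut_le (m : ℕ) :
    ∃ C : ℝ≥0, ∀ (r : ℝ → ℂ) (B : ℝ≥0), ContDiff ℝ m r →
      (∀ t ∈ Icc (-2 : ℝ) 2, ∀ l ≤ m, ‖iteratedDeriv l r t‖ ≤ B) →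
      ∀ l ≤ m, ∀ v, ‖iteratedDeriv l (fun v => r v * lowCut v) v‖ ≤ (C * B : ℝ≥0) := by
  obtain ⟨C, hC⟩ := exists_norm_iteratedDeriv_lowCut_le m
  refine ⟨2 ^ m * C, fun r B hr hB l hl v => ?_⟩
  by_cases hv : 2 < |v|
  · rw [iteratedDeriv_eq_zero_of_eq_zero_outside (a := 2)
      (fun u hu => by rw [lowCut_eq_zero hu, mul_zero]) l hv, norm_zero]
    positivity
  · refine (norm_iteratedDeriv_mul_le (hr.of_le (by exact_mod_cast hl)).contDiffAt
      (contDiff_lowCut l).contDiffAt (fun i hi => hB v (abs_le.1 (not_lt.1 hv)) i (hi.trans hl))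
      (fun i hi => hC i (hi.trans hl) v)).trans ?_
    push_cast
    rw [mul_assoc, mul_comm (B : ℝ)]
    gcongr
    norm_num

theorem IsKernel.exists_lintegral_rpow_mul_ft_lowSymbol_le (hk : IsKernel p k) {q : ℝ} (hq : 0 ≤ q)
    {m : ℕ} (hm : m ≤ ⌈p⌉₊) (hqm : q + 1 / 2 < m + 1) :
    ∃ C : ℝ≥0, ∀ (h : ℝ) (r : ℝ → ℂ) (B : ℝ≥0), 0 < h → h ≤ 1 → ContDiff ℝ (m + 1 : ℕ) r →
      (∀ t ∈ Icc (-2 : ℝ) 2, ∀ l ≤ m + 1, ‖iteratedDeriv l r t‖ ≤ B) →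
      ∫⁻ x, ENNReal.ofReal (|x| ^ q) * ‖ft (lowSymbol k r h) x‖ₑ ≤ C * B := by
  obtain ⟨M, hM⟩ := hk.exists_contDiffLipWith_scaledStar
  obtain ⟨C₁, hC₁⟩ := exists_norm_iteratedDeriv_mul_lowCut_le (m + 1)
  obtain ⟨C₂, hC₂⟩ := exists_lintegral_rpow_mul_enorm_ft_le hq hqm 2
  refine ⟨C₂ * (2 ^ m * (2 * (M * C₁))), fun h r B hh hh1 hr hB => ?_⟩
  have hlow : ContDiffLipWith m (2 ^ m * (2 * (M * (C₁ * B)))) (lowSymbol k r h) :=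
    ((hM h hh hh1).of_le hm).mul (.of_norm_iteratedDeriv_le (hr.mul (contDiff_lowCut _))
      (hC₁ r B hr hB))
  refine (hC₂ _ _ hlow fun v hv => lowSymbol_eq_zero k r h hv).trans_eq ?_
  push_cast
  ring

theorem IsKernel.exists_norm_iteratedDeriv_highSymbol_le (hk : IsKernel p k) {m : ℕ}
    (hm : m ≤ ⌈p⌉₊) :
    ∃ C : ℝ≥0, ∀ (h : ℝ) (r : ℝ → ℂ), 0 < h → h ≤ 1 → ContDiff ℝ m r → ∀ l ≤ m, ∀ v, 1 < |v| →
      ‖iteratedDeriv l (highSymbol k r h) v‖ ≤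
        C / |v| * ∑ j ∈ Finset.range (l + 1), ‖iteratedDeriv j r v‖ := by
  obtain ⟨M, hM⟩ := hk.exists_contDiffLipWith_scaledStar
  obtain ⟨C₁, hC₁⟩ := exists_norm_iteratedDeriv_highCut_le m
  refine ⟨2 ^ m * 2 ^ m * M * C₁, fun h r hh hh1 hr l hl v hv => ?_⟩
  have hr' {i : ℕ} (hi : i ≤ l) : ContDiffAt ℝ i r v :=
    (hr.of_le (by exact_mod_cast hi.trans hl)).contDiffAt
  set S := ∑ j ∈ Finset.range (l + 1), ‖iteratedDeriv j r v‖
  have r_mul_highCut_le (i : ℕ) (hi : i ≤ l) :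
      ‖iteratedDeriv i (fun v => r v * highCut v) v‖ ≤ 2 ^ m * (S * (C₁ / |v|)) := by
    refine (norm_iteratedDeriv_mul_le (A := S) (hr' hi) (contDiff_highCut i).contDiffAt
      (fun j hj => ?_) fun j hj => hC₁ j ((hj.trans hi).trans hl) v hv).trans ?_
    · exact Finset.single_le_sum (f := fun j => ‖iteratedDeriv j r v‖)
        (fun j _ => norm_nonneg _) (Finset.mem_range_succ_iff.2 (hj.trans hi))
    · gcongr
      exacts [one_le_two, hi.trans hl]
  calc ‖iteratedDeriv l (highSymbol k r h) v‖
      ≤ 2 ^ l * (M * (2 ^ m * (S * (C₁ / |v|)))) :=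
        norm_iteratedDeriv_mul_le (hk.contDiff_scaledStar h (hl.trans hm)).contDiffAt
          ((hr' le_rfl).mul (contDiff_highCut l).contDiffAt)
          (fun i hi => (hM h hh hh1).norm_le i ((hi.trans hl).trans hm) v) r_mul_highCut_le
    _ ≤ 2 ^ m * (M * (2 ^ m * (S * (C₁ / |v|)))) := by
        gcongr
        exact one_le_two
    _ = (2 ^ m * 2 ^ m * M * C₁ : ℝ≥0) / |v| * S := by
        push_cast
        ring

theorem IsKernel.exists_norm_sq_iteratedDeriv_highSymbol_le (hk : IsKernel p k) {m : ℕ}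
    (hm : m ≤ ⌈p⌉₊) :
    ∃ C : ℝ≥0, ∀ (h : ℝ) (r : ℝ → ℂ), 0 < h → h ≤ 1 → ContDiff ℝ m r → ∀ l ≤ m, ∀ v, 1 < |v| →
      ‖iteratedDeriv l (highSymbol k r h) v‖ ^ 2 ≤
        C * ∑ j ∈ Finset.range (l + 1), ‖iteratedDeriv j r v‖ ^ 2 / |v| ^ 2 := by
  obtain ⟨D, hD⟩ := hk.exists_norm_iteratedDeriv_highSymbol_le hm
  refine ⟨D ^ 2 * (m + 1), fun h r hh hh1 hr l hl v hv => ?_⟩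
  push_cast
  calc ‖iteratedDeriv l (highSymbol k r h) v‖ ^ 2
      ≤ (D / |v| * ∑ j ∈ Finset.range (l + 1), ‖iteratedDeriv j r v‖) ^ 2 := by
        gcongr
        exact hD h r hh hh1 hr l hl v hv
    _ = D ^ 2 / |v| ^ 2 * (∑ j ∈ Finset.range (l + 1), ‖iteratedDeriv j r v‖) ^ 2 := by ring
    _ ≤ D ^ 2 / |v| ^ 2 *
        ((m + 1) * ∑ j ∈ Finset.range (l + 1), ‖iteratedDeriv j r v‖ ^ 2) := by
        gcongr
        refine sq_sum_le_card_mul_sum_sq.trans ?_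
        gcongr
        rw [Finset.card_range]
        exact_mod_cast Nat.succ_le_succ hl
    _ = _ := by
        rw [← Finset.sum_div]
        ring

theorem IsKernel.iteratedDeriv_highSymbol_eq_zero (hk : IsKernel p k) (r : ℝ → ℂ) (hh : 0 < h)
    (l : ℕ) (hv : |v| < 1 ∨ 1 / h < |v|) : iteratedDeriv l (highSymbol k r h) v = 0 := by
  rcases hv with hv | hv
  · have eventually_zero : highSymbol k r h =ᶠ[nhds v] fun _ => 0 := by
      filter_upwards [continuous_abs.tendsto v |>.eventually (gt_mem_nhds hv)] with u hu
      exact highSymbol_eq_zero_of_abs_le_one k r h (le_of_lt hu)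
    rw [eventually_zero.iteratedDeriv_eq, iteratedDeriv_const]
    split_ifs <;> rfl
  · exact iteratedDeriv_eq_zero_of_eq_zero_outside (fun u hu => hk.highSymbol_eq_zero r hh hu) l hv

theorem ae_abs_lt_one_or_lt_abs_of_notMem (b : ℝ) :
    ∀ᵐ v : ℝ, v ∉ Icc (-b) b ∩ (Icc (-1 : ℝ) 1)ᶜ → |v| < 1 ∨ b < |v| := by
  have hne : ∀ᵐ v : ℝ, v ∉ ({1, -1} : Set ℝ) :=
    measure_eq_zero_iff_ae_notMem.1 ((Set.toFinite _).measure_zero _)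
  filter_upwards [hne] with v hv hvS
  by_contra! hcon
  refine hvS ⟨abs_le.1 hcon.2, fun h => hv ?_⟩
  exact eq_or_eq_neg_of_abs_eq (le_antisymm (abs_le.2 h) hcon.1)

theorem lintegral_sum_eq_sum_outerIntegral {l : ℕ} (hr : ContDiff ℝ l r) (h : ℝ) :
    ∫⁻ v in Icc (-(1 / h)) (1 / h) ∩ (Icc (-1 : ℝ) 1)ᶜ, ∑ j ∈ Finset.range (l + 1),
      ENNReal.ofReal (‖iteratedDeriv j r v‖ ^ 2 / |v| ^ 2) =
    ∑ j ∈ Finset.range (l + 1), outerIntegral r h j := by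
  refine lintegral_finsetSum _ fun j hj => ?_
  have := (hr.continuous_iteratedDeriv j
    (by exact_mod_cast Finset.mem_range_succ_iff.1 hj)).measurable
  fun_prop

theorem IsKernel.exists_lintegral_iteratedDeriv_highSymbol_le (hk : IsKernel p k) {m : ℕ}
    (hm : m ≤ ⌈p⌉₊) :
    ∃ C : ℝ≥0, ∀ (h : ℝ) (r : ℝ → ℂ), 0 < h → h ≤ 1 → ContDiff ℝ m r → ∀ l ≤ m,
      ∫⁻ v, ‖iteratedDeriv l (highSymbol k r h) v‖ₑ ^ 2 ≤
        C * ∑ j ∈ Finset.range (l + 1), outerIntegral r h j := by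
  obtain ⟨C, hC⟩ := hk.exists_norm_sq_iteratedDeriv_highSymbol_le hm
  refine ⟨C, fun h r hh hh1 hr l hl => ?_⟩
  set S : Set ℝ := Icc (-(1 / h)) (1 / h) ∩ (Icc (-1 : ℝ) 1)ᶜ
  have hS : MeasurableSet S := measurableSet_Icc.inter measurableSet_Icc.compl
  have bound_ae : ∀ᵐ v, ‖iteratedDeriv l (highSymbol k r h) v‖ₑ ^ 2 ≤
      S.indicator (fun v => C * ∑ j ∈ Finset.range (l + 1),
        ENNReal.ofReal (‖iteratedDeriv j r v‖ ^ 2 / |v| ^ 2)) v := by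
    filter_upwards [ae_abs_lt_one_or_lt_abs_of_notMem (1 / h)] with v hv
    by_cases hvS : v ∈ S
    · rw [indicator_of_mem hvS, ← ofReal_norm, ← ENNReal.ofReal_pow (norm_nonneg _),
        ← ENNReal.ofReal_sum_of_nonneg (fun j _ => by positivity), ← ENNReal.ofReal_coe_nnreal,
        ← ENNReal.ofReal_mul NNReal.zero_le_coe]
      exact ENNReal.ofReal_le_ofReal
        (hC h r hh hh1 hr l hl v (not_le.1 fun hle => hvS.2 (abs_le.1 hle)))
    · rw [hk.iteratedDeriv_highSymbol_eq_zero r hh l (hv hvS), enorm_zero, zero_pow two_ne_zero]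
      exact zero_le
  refine (lintegral_mono_ae bound_ae).trans_eq ?_
  rw [lintegral_indicator hS, lintegral_const_mul' _ _ ENNReal.coe_ne_top,
    lintegral_sum_eq_sum_outerIntegral (hr.of_le (by exact_mod_cast hl))]

end Symbols

/-! ### Densities with a prescribed Fourier transform -/

section Density

variable {f g : ℝ → ℂ} {a : ℝ → ℝ}

/-- The real density `x ↦ Re (2π)⁻¹ ∫ e^{-ivx} g(v) dv`, whose characteristic function is `g` when
`g` is conjugate symmetric. -/
noncomputable def density (g : ℝ → ℂ) (x : ℝ) : ℝ := (1 / (2 * (Real.pi : ℂ)) * ft g x).re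

/-- The primitive vanishing at `-∞` of an integrable function. -/
noncomputable def primitive (a : ℝ → ℝ) (x : ℝ) : ℝ := ∫ u in Iic x, a u

theorem abs_density_le (g : ℝ → ℂ) (x : ℝ) : |density g x| ≤ ‖ft g x‖ := by
  refine (Complex.abs_re_le_norm _).trans ?_
  rw [norm_mul]
  refine mul_le_of_le_one_left (norm_nonneg _) ?_
  rw [norm_div, norm_one, norm_mul, Complex.norm_real, Real.norm_of_nonneg Real.pi_pos.le,
    Complex.norm_ofNat, div_le_one (by positivity)]
  linarith [Real.pi_gt_three]

open scoped FourierTransform in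
theorem measurable_density (g : ℝ → ℂ) : Measurable (density g) := by
  by_cases hg : Integrable g
  · exact (Complex.continuous_re.comp (continuous_const.mul (continuous_ft hg))).measurable
  · have fourier_eq_zero : 𝓕 g = 0 := funext fun x =>
      integral_undef fun hi => hg ((Real.fourierIntegral_convergent_iff x).1 hi)
    have density_eq_zero : density g = 0 := funext fun x => by simp [density, ft, fourier_eq_zero]
    exact density_eq_zero ▸ measurable_zero

theorem integrable_density (hg : ContDiff ℝ 1 g) (hc : HasCompactSupport g) :
    Integrable (density g) :=
  ((integrable_ft hg hc).const_mul _).re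

theorem density_add (hf : Integrable f) (hg : Integrable g) (x : ℝ) :
    density (fun v => f v + g v) x = density f x + density g x := by
  simp only [density, ft_eq_integral, mul_add]
  rw [integral_add (integrable_exp_mul hf x) (integrable_exp_mul hg x), mul_add, Complex.add_re]

theorem abs_primitive_le (ha : Integrable a) (x : ℝ) : |primitive a x| ≤ ∫ u, |a u| :=
  (norm_integral_le_integral_norm _).trans
    (setIntegral_le_integral ha.norm (.of_forall fun _ => norm_nonneg _))

theorem measurable_primitive (ha : Measurable a) : Measurable (primitive a) := by
  have indicator_measurable : StronglyMeasurable fun z : ℝ × ℝ =>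
      {z : ℝ × ℝ | z.2 ≤ z.1}.indicator (fun z => a z.2) z :=
    (ha.comp measurable_snd).stronglyMeasurable.indicator
      (measurableSet_le measurable_snd measurable_fst)
  convert (indicator_measurable.integral_prod_right' (ν := volume)).measurable using 2 with x
  rw [primitive, ← integral_indicator measurableSet_Iic]
  rfl

theorem setIntegral_Iic_comp_sub (a : ℝ → ℝ) (t y : ℝ) :
    ∫ u in Iic t, a (u - y) = primitive a (t - y) := by
  rw [primitive, ← (measurePreserving_sub_right (volume : Measure ℝ) y).setIntegral_preimage_emb
    (MeasurableEquiv.subRight y).measurableEmbedding a (Iic (t - y))]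
  congr 2
  ext u
  simp

theorem hasDerivAt_ft (hg : Continuous g) (hc : HasCompactSupport g) (x : ℝ) :
    HasDerivAt (ft g) (ft (fun v => -Complex.I * v * g v) x) x := by
  have hpi : (Real.pi : ℂ) ≠ 0 := by exact_mod_cast Real.pi_ne_zero
  have hi : Integrable fun v : ℝ => v • g v :=
    (continuous_id.smul hg).integrable_of_hasCompactSupport hc.smul_left
  have chain := (Real.hasDerivAt_fourier (hg.integrable_of_hasCompactSupport hc) hi
    (x / (2 * Real.pi))).scomp x ((hasDerivAt_id x).div_const (2 * Real.pi))
  refine HasDerivAt.congr_deriv (f := ft g) chain ?_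
  change (1 / (2 * Real.pi) : ℝ) • ft (fun v : ℝ => (-2 * Real.pi * Complex.I * v : ℂ) • g v) x = _
  rw [ft_eq_integral, ft_eq_integral, ← integral_smul]
  congr with v
  rw [Complex.real_smul, smul_eq_mul]
  push_cast
  field_simp

theorem tendsto_ft_atBot (g : ℝ → ℂ) : Filter.Tendsto (ft g) Filter.atBot (nhds 0) :=
  ((Real.zero_at_infty_fourier g).mono_left atBot_le_cocompact).comp
    (Filter.tendsto_id.atBot_div_const (by positivity))

theorem hasDerivAt_density (hg : Continuous g) (hc : HasCompactSupport g) (x : ℝ) :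
    HasDerivAt (density g) (density (fun v => -Complex.I * v * g v) x) x :=
  Complex.reCLM.hasFDerivAt.comp_hasDerivAt x ((hasDerivAt_ft hg hc x).const_mul _)

theorem tendsto_density_atBot (g : ℝ → ℂ) :
    Filter.Tendsto (density g) Filter.atBot (nhds 0) := by
  have h := (tendsto_ft_atBot g).const_mul (1 / (2 * (Real.pi : ℂ)))
  rw [mul_zero] at h
  exact (Complex.continuous_re.tendsto 0).comp h

theorem contDiff_neg_I_mul (hg : ContDiff ℝ 1 g) :
    ContDiff ℝ 1 fun v : ℝ => -Complex.I * v * g v :=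
  (contDiff_const.mul Complex.ofRealCLM.contDiff).mul hg

theorem primitive_density_neg_I_mul (hg : ContDiff ℝ 1 g) (hc : HasCompactSupport g) (x : ℝ) :
    primitive (density fun v => -Complex.I * v * g v) x = density g x := by
  have hderiv (u : ℝ) := hasDerivAt_density hg.continuous hc u
  have ftc := integral_Iic_of_hasDerivAt_of_tendsto (a := x)
    (hderiv x).continuousAt.continuousWithinAt (fun u _ => hderiv u)
    (integrable_density (contDiff_neg_I_mul hg) hc.mul_left).integrableOn (tendsto_density_atBot g)
  rwa [sub_zero] at ftc

theorem ofReal_density (hg : ∀ v, (starRingEnd ℂ) (g (-v)) = g v) (x : ℝ) :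
    ((density g x : ℝ) : ℂ) = 1 / (2 * (Real.pi : ℂ)) * ft g x := by
  rw [density]
  refine Complex.conj_eq_iff_re.1 ?_
  rw [map_mul, map_div₀, map_one, map_mul, Complex.conj_ofReal, Complex.conj_ofNat]
  congr 1
  rw [ft_eq_integral, ← integral_conj, ← integral_neg_eq_self]
  congr with v
  rw [map_mul, hg, ← Complex.exp_conj]
  congr 2
  simp

open scoped FourierTransform in
theorem integral_exp_mul_ft (hg : ContDiff ℝ 1 g) (hc : HasCompactSupport g) (t : ℝ) :
    ∫ x : ℝ, Complex.exp (t * x * Complex.I) * (1 / (2 * (Real.pi : ℂ)) * ft g x) = g t := by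
  have hpi : (0 : ℝ) < 2 * Real.pi := by positivity
  have hpi' : (Real.pi : ℂ) ≠ 0 := by exact_mod_cast Real.pi_ne_zero
  have integrable_fourier : Integrable (𝓕 g) := by
    refine ((integrable_ft hg hc).comp_mul_left' hpi.ne').congr (.of_forall fun x => ?_)
    simp only [ft]
    rw [mul_div_cancel_left₀ _ hpi.ne']
  have rescale := Measure.integral_comp_mul_left (fun x : ℝ => Complex.exp (t * x * Complex.I) *
    (1 / (2 * (Real.pi : ℂ)) * ft g x)) (2 * Real.pi)
  rw [abs_of_pos (inv_pos.2 hpi), eq_inv_smul_iff₀ hpi.ne'] at rescale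
  rw [← rescale, ← congrFun (hg.continuous.fourierInv_fourier_eq
    (hg.continuous.integrable_of_hasCompactSupport hc) integrable_fourier) t,
    Real.fourierInv_eq', ← integral_smul]
  congr with x
  have phase : ((t * (2 * Real.pi * x : ℝ)) * Complex.I : ℂ) =
      (2 * Real.pi * (inner ℝ x t : ℝ) : ℝ) * Complex.I := by
    simp only [RCLike.inner_apply, conj_trivial]
    push_cast
    ring
  rw [ft, mul_div_cancel_left₀ _ hpi.ne', Complex.real_smul, smul_eq_mul, phase]
  push_cast
  field_simp

end Density

/-! ### The preliminary estimator as an empirical mean -/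

section Estimator

variable {p : ℝ} {k : ℝ → ℝ} {με : Measure ℝ} {h : ℝ}

theorem deconvKernel_div_eq (k : ℝ → ℝ) (με : Measure ℝ) (hh : 0 < h) (x : ℝ) :
    deconvKernel k με h (x / h) = h * density (symbol k (recipChar με) h) x := by
  have hh' : (h : ℂ) ≠ 0 := by exact_mod_cast hh.ne'
  have integrand_eq (v : ℝ) : Complex.exp (Complex.I * (-h * v : ℝ) * (x / h : ℝ)) *
      fourierStar k (-h * v) / charFun με (-(-h * v) / h) =
      Complex.exp (-(Complex.I * v * x)) * symbol k (recipChar με) h v := by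
    have charFun_arg : -(-h * v) / h = v := by field_simp
    have phase : Complex.I * (-h * v : ℝ) * (x / h : ℝ) = -(Complex.I * v * x) := by
      push_cast
      field_simp
    rw [charFun_arg, phase, symbol, scaledStar, recipChar]
    ring
  have rescale := Measure.integral_comp_mul_left (fun u : ℝ =>
    Complex.exp (Complex.I * u * (x / h : ℝ)) * fourierStar k u / charFun με (-u / h)) (-h)
  simp only [integrand_eq] at rescale
  rw [← ft_eq_integral, inv_neg, abs_neg, abs_of_pos (inv_pos.2 hh),
    eq_inv_smul_iff₀ hh.ne'] at rescale
  rw [deconvKernel, ← rescale, density, ← Complex.re_ofReal_mul, Complex.real_smul]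
  congr 1
  ring

theorem prelimEstimator_eq {n : ℕ} (hh : 0 < h)
    (hi : Integrable (density (symbol k (recipChar με) h))) (y : Fin n → ℝ) (t : ℝ) :
    prelimEstimator k με h y t =
      1 / (n : ℝ) * ∑ j, primitive (density (symbol k (recipChar με) h)) (t - y j) := by
  simp only [prelimEstimator, deconvKernel_div_eq k με hh]
  rw [integral_finsetSum _ fun j _ => ((hi.comp_sub_right (y j)).const_mul h).integrableOn]
  simp only [integral_const_mul, setIntegral_Iic_comp_sub]
  rw [← Finset.mul_sum, ← mul_assoc]
  congr 1
  rw [one_div, one_div, mul_inv, mul_assoc, inv_mul_cancel₀ hh.ne', mul_one]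

theorem conj_fourierStar (k : ℝ → ℝ) (x : ℝ) :
    (starRingEnd ℂ) (fourierStar k x) = fourierStar k (-x) := by
  rw [fourierStar, fourierStar, ← integral_conj]
  congr with u
  rw [map_mul, ← Complex.exp_conj, Complex.conj_ofReal]
  congr 2
  simp

theorem fourierStar_neg (hk : ∀ x, k (-x) = k x) (x : ℝ) :
    fourierStar k (-x) = fourierStar k x := by
  rw [fourierStar, fourierStar, ← integral_neg_eq_self]
  congr with u
  rw [hk]
  congr 2
  push_cast
  ring

theorem conj_symbol_neg (k : ℝ → ℝ) (με : Measure ℝ) (h v : ℝ) :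
    (starRingEnd ℂ) (symbol k (recipChar με) h (-v)) = symbol k (recipChar με) h v := by
  rw [symbol, symbol, map_mul, scaledStar, scaledStar, conj_fourierStar, recipChar, recipChar,
    map_div₀, map_one, charFun_neg, Complex.conj_conj]
  congr 2
  ring

/-- The law with density `h⁻¹ k(x/h)`: the smoothing kernel at bandwidth `h`. -/
noncomputable def kernelLaw (k : ℝ → ℝ) (h : ℝ) : Measure ℝ :=
  (volume.withDensity fun x => ENNReal.ofReal (k x)).map (h * ·)

theorem IsKernel.isProbabilityMeasure_kernelLaw (hk : IsKernel p k) (h : ℝ) :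
    IsProbabilityMeasure (kernelLaw k h) := by
  have : IsProbabilityMeasure (volume.withDensity fun x => ENNReal.ofReal (k x)) := by
    constructor
    rw [withDensity_apply _ MeasurableSet.univ, Measure.restrict_univ,
      ← ofReal_integral_eq_lintegral_ofReal hk.integrable (.of_forall hk.nonneg),
      hk.integral_eq_one, ENNReal.ofReal_one]
  exact Measure.isProbabilityMeasure_map (by fun_prop)

theorem IsKernel.charFun_kernelLaw (hk : IsKernel p k) (h t : ℝ) :
    charFun (kernelLaw k h) t = scaledStar k h t := by
  rw [kernelLaw, charFun_map_mul, charFun_apply_real,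
    integral_withDensity_ofReal hk.integrable.aemeasurable,
    scaledStar, neg_mul, fourierStar_neg hk.symm, fourierStar]
  congr with x
  rw [max_eq_left (hk.nonneg x)]
  congr 2
  push_cast
  ring

theorem IsKernel.lintegral_rpow_kernelLaw (hk : IsKernel p k) (hh : 0 < h) (q : ℝ) :
    ∫⁻ z, ENNReal.ofReal (|z| ^ q) ∂(kernelLaw k h) =
      ENNReal.ofReal (h ^ q) * ∫⁻ x, ENNReal.ofReal (|x| ^ q * k x) := by
  rw [kernelLaw, lintegral_map (by fun_prop) (by fun_prop),
    lintegral_withDensity_eq_lintegral_mul₀ hk.integrable.aemeasurable.ennreal_ofReal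
      (by fun_prop), ← lintegral_const_mul' _ _ ENNReal.ofReal_ne_top]
  refine lintegral_congr fun x => ?_
  simp only [Pi.mul_apply]
  rw [← ENNReal.ofReal_mul (hk.nonneg x), ← ENNReal.ofReal_mul (by positivity), abs_mul,
    abs_of_pos hh, Real.mul_rpow hh.le (abs_nonneg x)]
  congr 1
  ring

theorem IsKernel.hasCompactSupport_symbol (hk : IsKernel p k) (r : ℝ → ℂ) (hh : 0 < h) :
    HasCompactSupport (symbol k r h) :=
  hasCompactSupport_of_eq_zero_outside fun _ hv => hk.symbol_eq_zero r hh hv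

theorem hasCompactSupport_lowSymbol (k : ℝ → ℝ) (r : ℝ → ℂ) (h : ℝ) :
    HasCompactSupport (lowSymbol k r h) :=
  hasCompactSupport_of_eq_zero_outside fun _ hv => lowSymbol_eq_zero k r h hv

theorem IsKernel.hasCompactSupport_highSymbol (hk : IsKernel p k) (r : ℝ → ℂ) (hh : 0 < h) :
    HasCompactSupport (highSymbol k r h) :=
  hasCompactSupport_of_eq_zero_outside fun _ hv => hk.highSymbol_eq_zero r hh hv

theorem IsKernel.integral_primitive_density_symbol (hk : IsKernel p k) (hp : 1 ≤ ⌈p⌉₊) (hh : 0 < h)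
    (μ με : Measure ℝ) [IsProbabilityMeasure μ] [IsProbabilityMeasure με]
    (hne : ∀ t, charFun με t ≠ 0) (hr : ContDiff ℝ 1 (recipChar με)) (t : ℝ) :
    ∫ y, primitive (density (symbol k (recipChar με) h)) (t - y) ∂(Measure.conv μ με) =
      cdf (Measure.conv μ (kernelLaw k h)) t := by
  have := hk.isProbabilityMeasure_kernelLaw h
  have hg := hk.contDiff_symbol (r := recipChar με) hp (by exact_mod_cast hr) h
  have hc := hk.hasCompactSupport_symbol (recipChar με) hh
  rw [cdf_eq_real]
  refine integral_setIntegral_Iic_sub_eq (integrable_density hg hc) (fun s => ?_) t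
  simp only [ofReal_density (conj_symbol_neg k με h)]
  rw [integral_exp_mul_ft hg hc, charFun_conv, charFun_conv, hk.charFun_kernelLaw, symbol,
    recipChar, mul_one_div, mul_comm (charFun μ s), ← mul_assoc,
    div_mul_cancel₀ _ (hne s), mul_comm]

theorem symbol_eq_lowSymbol_add (k : ℝ → ℝ) (r : ℝ → ℂ) (h v : ℝ) :
    symbol k r h v = lowSymbol k r h v + -Complex.I * v * highSymbol k r h v := by
  rw [symbol, lowSymbol, highSymbol]
  linear_combination -(scaledStar k h v * r v) * neg_I_mul_highCut v

-- Division by `-iv` integrates the high frequencies exactly, so that only the low frequencies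
-- contribute to the jump of `primitive` at infinity.
theorem IsKernel.primitive_density_symbol_eq (hk : IsKernel p k) (hp : 1 ≤ ⌈p⌉₊) {r : ℝ → ℂ}
    (hr : ContDiff ℝ 1 r) (hh : 0 < h) (x : ℝ) :
    primitive (density (symbol k r h)) x =
      primitive (density (lowSymbol k r h)) x + density (highSymbol k r h) x := by
  have hr' : ContDiff ℝ (1 : ℕ) r := by exact_mod_cast hr
  have hlow := hk.contDiff_lowSymbol hp hr' h
  have hlow_supp := hasCompactSupport_lowSymbol k r h
  have hhigh := hk.contDiff_highSymbol hp hr' h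
  have hhigh_supp := hk.hasCompactSupport_highSymbol r hh
  have hhigh_deriv := contDiff_neg_I_mul hhigh
  have split (u : ℝ) : density (symbol k r h) u = density (lowSymbol k r h) u +
      density (fun v => -Complex.I * v * highSymbol k r h v) u := by
    rw [funext (symbol_eq_lowSymbol_add k r h)]
    exact density_add (hlow.continuous.integrable_of_hasCompactSupport hlow_supp)
      (hhigh_deriv.continuous.integrable_of_hasCompactSupport hhigh_supp.mul_left) u
  rw [← primitive_density_neg_I_mul hhigh hhigh_supp]
  simp only [primitive, split]
  exact integral_add (integrable_density hlow hlow_supp).integrableOn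
    (integrable_density hhigh_deriv hhigh_supp.mul_left).integrableOn

end Estimator

/-! ### Weighted standard deviations -/

section PrimitiveStdDev

theorem ofReal_abs_primitive_sub_le {a : ℝ → ℝ} (ha : Integrable a) (x y : ℝ) :
    ENNReal.ofReal |primitive a (x - y) - if x < 0 then 0 else ∫ u, a u| ≤
      (∫⁻ u in {u | |x| / 2 ≤ |u|}, ‖a u‖ₑ) +
        {y | |x| / 2 ≤ |y|}.indicator (fun _ => ∫⁻ u, ‖a u‖ₑ) y := by
  obtain ⟨s, hs, hsub⟩ : ∃ s : Set ℝ,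
      |primitive a (x - y) - if x < 0 then 0 else ∫ u, a u| = |∫ u in s, a u| ∧
      (|y| < |x| / 2 → s ⊆ {u | |x| / 2 ≤ |u|}) := by
    by_cases hx : x < 0
    · refine ⟨Iic (x - y), by simp [hx, primitive], fun hy u hu => ?_⟩
      rw [abs_of_neg hx] at hy
      rw [mem_Iic] at hu
      rw [mem_ofPred_eq, abs_of_neg hx]
      exact le_abs.2 (.inr (by linarith [neg_abs_le y]))
    · refine ⟨Ioi (x - y), ?_, fun hy u hu => ?_⟩
      · have hadd := intervalIntegral.integral_Iic_add_Ioi (b := x - y) (f := a) (μ := volume)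
          ha.integrableOn ha.integrableOn
        rw [if_neg hx, ← hadd, primitive, sub_add_cancel_left, abs_neg]
      · rw [abs_of_nonneg (not_lt.1 hx)] at hy
        rw [mem_Ioi] at hu
        rw [mem_ofPred_eq, abs_of_nonneg (not_lt.1 hx)]
        exact le_abs.2 (.inl (by linarith [le_abs_self y]))
  have hle : ENNReal.ofReal |∫ u in s, a u| ≤ ∫⁻ u in s, ‖a u‖ₑ := by
    rw [← Real.enorm_eq_ofReal_abs]
    exact enorm_integral_le_lintegral_enorm _
  rw [hs]
  refine hle.trans ?_
  by_cases hy : |x| / 2 ≤ |y|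
  · rw [indicator_of_mem (by exact hy)]
    exact (setLIntegral_le_lintegral _ _).trans le_add_self
  · exact (lintegral_mono_set (hsub (not_le.1 hy))).trans le_self_add

theorem lintegral_sq_primitive_sub_rpow_half_le {a : ℝ → ℝ} (ha : Integrable a) (ν : Measure ℝ)
    [IsProbabilityMeasure ν] (x : ℝ) :
    (∫⁻ y, ENNReal.ofReal ((primitive a (x - y) - if x < 0 then 0 else ∫ u, a u) ^ 2) ∂ν) ^
        (1 / 2 : ℝ) ≤
      (∫⁻ u in {u | |x| / 2 ≤ |u|}, ‖a u‖ₑ) +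
        (∫⁻ u, ‖a u‖ₑ) * ν {y | |x| / 2 ≤ |y|} ^ (1 / 2 : ℝ) := by
  set T := ∫⁻ u in {u | |x| / 2 ≤ |u|}, ‖a u‖ₑ
  set N := ∫⁻ u, ‖a u‖ₑ
  set S := {y : ℝ | |x| / 2 ≤ |y|}
  have hS : MeasurableSet S := measurableSet_le (by fun_prop) (by fun_prop)
  have sq_rpow_half (t : ℝ≥0∞) : (t ^ (2 : ℝ)) ^ (1 / 2 : ℝ) = t := by
    rw [← ENNReal.rpow_mul]
    norm_num
  have indicator_sq (y : ℝ) : S.indicator (fun _ => N) y ^ (2 : ℝ) =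
      S.indicator (fun _ => N ^ (2 : ℝ)) y := by
    by_cases hy : y ∈ S <;> simp [hy]
  have minkowski := ENNReal.lintegral_Lp_add_le (μ := ν) (p := 2) (f := fun _ => T)
    (g := S.indicator fun _ => N) aemeasurable_const (measurable_const.indicator hS).aemeasurable
    one_le_two
  simp only [indicator_sq, lintegral_const, measure_univ, mul_one, lintegral_indicator hS,
    Measure.restrict_apply_univ, sq_rpow_half, Pi.add_apply,
    ENNReal.mul_rpow_of_nonneg _ _ one_half_pos.le] at minkowski
  refine le_trans ?_ minkowski
  gcongr with y
  rw [← sq_abs, ENNReal.ofReal_pow (abs_nonneg _), ENNReal.rpow_two]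
  gcongr
  exact ofReal_abs_primitive_sub_le ha x y

theorem lintegral_comp_abs {f : ℝ → ℝ≥0∞} (hf : Measurable f) :
    ∫⁻ x, f |x| = 2 * ∫⁻ x in Ioi 0, f x := by
  have hpos : ∫⁻ x in Ioi (0 : ℝ), f |x| = ∫⁻ x in Ioi 0, f x :=
    setLIntegral_congr_fun measurableSet_Ioi fun x hx => by rw [abs_of_pos hx]
  have hneg : ∫⁻ x in Iic (0 : ℝ), f |x| = ∫⁻ x in Ioi 0, f x := by
    have h := (Measure.measurePreserving_neg (volume : Measure ℝ)).setLIntegral_comp_preimage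
      (s := Ici 0) measurableSet_Ici (f := fun x => f |x|) (by fun_prop)
    simp only [abs_neg, neg_preimage, Set.neg_Ici, neg_zero] at h
    rw [h, setLIntegral_congr Ioi_ae_eq_Ici.symm, hpos]
  rw [← lintegral_add_compl _ (measurableSet_Iic (a := (0 : ℝ))), compl_Iic, hneg, hpos, two_mul]

theorem lintegral_rpow_mul_comp_half (p : ℝ) (φ : ℝ → ℝ≥0∞) :
    ∫⁻ x, ENNReal.ofReal (|x| ^ (p - 1)) * φ (|x| / 2) =
      ENNReal.ofReal (2 ^ p) * ∫⁻ x, ENNReal.ofReal (|x| ^ (p - 1)) * φ |x| := by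
  have rescale (x : ℝ) : ENNReal.ofReal (|x| ^ (p - 1)) * φ (|x| / 2) =
      ENNReal.ofReal (2 ^ (p - 1)) * (ENNReal.ofReal (|x / 2| ^ (p - 1)) * φ |x / 2|) := by
    rw [← mul_assoc, ← ENNReal.ofReal_mul (by positivity),
      ← Real.mul_rpow zero_le_two (abs_nonneg _), abs_div, abs_two, mul_div_cancel₀ _ two_ne_zero]
  simp only [rescale]
  rw [lintegral_const_mul' _ _ ENNReal.ofReal_ne_top,
    lintegral_comp_div (fun x => ENNReal.ofReal (|x| ^ (p - 1)) * φ |x|) two_pos, ← mul_assoc,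
    ← ENNReal.ofReal_mul (by positivity), ← Real.rpow_add_one two_ne_zero, sub_add_cancel]

theorem setLIntegral_abs_le_rpow {p : ℝ} (hp : 0 < p) (u : ℝ) :
    ∫⁻ x in {x | |x| ≤ |u|}, ENNReal.ofReal (|x| ^ (p - 1)) =
      ENNReal.ofReal (2 / p) * ENNReal.ofReal (|u| ^ p) := by
  have fold := lintegral_comp_abs (f := (Iic |u|).indicator fun x => ENNReal.ofReal
    (|x| ^ (p - 1))) (Measurable.indicator (by fun_prop) measurableSet_Iic)
  rw [setLIntegral_indicator measurableSet_Iic, inter_comm, Ioi_inter_Iic,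
    setLIntegral_Ioc_abs_rpow (by linarith) le_rfl (abs_nonneg u)] at fold
  rw [← lintegral_indicator (measurableSet_le (by fun_prop) (by fun_prop))]
  refine Eq.trans (lintegral_congr fun x => ?_) (fold.trans ?_)
  · simp only [indicator, mem_ofPred_eq, mem_Iic, abs_abs]
  · rw [sub_add_cancel, Real.zero_rpow hp.ne', sub_zero, ← ENNReal.ofReal_ofNat 2,
      ← ENNReal.ofReal_mul zero_le_two, ← ENNReal.ofReal_mul (by positivity)]
    ring_nf

theorem lintegral_rpow_mul_setLIntegral {p : ℝ} (hp : 0 < p) {f : ℝ → ℝ≥0∞}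
    (hf : Measurable f) :
    ∫⁻ x, ENNReal.ofReal (|x| ^ (p - 1)) * ∫⁻ u in {u | |x| ≤ |u|}, f u =
      ENNReal.ofReal (2 / p) * ∫⁻ u, ENNReal.ofReal (|u| ^ p) * f u := by
  have hmS (x : ℝ) : MeasurableSet {u : ℝ | |x| ≤ |u|} :=
    measurableSet_le (by fun_prop) (by fun_prop)
  have hmS' (u : ℝ) : MeasurableSet {x : ℝ | |x| ≤ |u|} :=
    measurableSet_le (by fun_prop) (by fun_prop)
  have hm : Measurable fun z : ℝ × ℝ => {z : ℝ × ℝ | |z.1| ≤ |z.2|}.indicator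
      (fun z => ENNReal.ofReal (|z.1| ^ (p - 1)) * f z.2) z :=
    Measurable.indicator (by fun_prop) (measurableSet_le (by fun_prop) (by fun_prop))
  calc _ = ∫⁻ x, ∫⁻ u, {z : ℝ × ℝ | |z.1| ≤ |z.2|}.indicator
        (fun z => ENNReal.ofReal (|z.1| ^ (p - 1)) * f z.2) (x, u) := by
        refine lintegral_congr fun x => ?_
        rw [← lintegral_indicator (hmS x), ← lintegral_const_mul' _ _ ENNReal.ofReal_ne_top]
        refine lintegral_congr fun u => ?_
        simp only [indicator, mem_ofPred_eq, mul_ite, mul_zero]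
    _ = ∫⁻ u, ∫⁻ x in {x | |x| ≤ |u|}, ENNReal.ofReal (|x| ^ (p - 1)) * f u := by
        rw [lintegral_lintegral_swap hm.aemeasurable]
        refine lintegral_congr fun u => ?_
        rw [← lintegral_indicator (hmS' u)]
        rfl
    _ = _ := by
        rw [← lintegral_const_mul' _ _ ENNReal.ofReal_ne_top]
        refine lintegral_congr fun u => ?_
        rw [lintegral_mul_const _ (by fun_prop), setLIntegral_abs_le_rpow hp, mul_assoc]

theorem weightedStdDev_primitive_le {p : ℝ} (hp : 1 ≤ p) {a : ℝ → ℝ} (ham : Measurable a)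
    (ha : Integrable a) (ν : Measure ℝ) [IsProbabilityMeasure ν] :
    weightedStdDev p ν (primitive a) (fun x => if x < 0 then 0 else ∫ u, a u) ≤
      ENNReal.ofReal (2 ^ p * 2) * ((∫⁻ u, ENNReal.ofReal (|u| ^ p) * ‖a u‖ₑ) +
        (∫⁻ u, ‖a u‖ₑ) * ∫⁻ x in Ioi 0,
          ENNReal.ofReal (|x| ^ (p - 1)) * ν {y | x ≤ |y|} ^ (1 / 2 : ℝ)) := by
  set N := ∫⁻ u, ‖a u‖ₑ
  have hν : Measurable fun c => ν {y | c ≤ |y|} ^ (1 / 2 : ℝ) :=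
    (Antitone.measurable (f := fun c => ν {y | c ≤ |y|}) fun c d hcd =>
      measure_mono fun y hy => hcd.trans hy).pow_const _
  have hT : Measurable fun c => ∫⁻ u in {u | c ≤ |u|}, ‖a u‖ₑ :=
    Antitone.measurable fun c d hcd => lintegral_mono_set fun y hy => hcd.trans hy
  have tail_measurable : Measurable fun x : ℝ => ENNReal.ofReal (|x| ^ (p - 1)) *
      ∫⁻ u in {u | |x| / 2 ≤ |u|}, ‖a u‖ₑ :=
    .mul (by fun_prop) (hT.comp (by fun_prop : Measurable fun x : ℝ => |x| / 2))
  have tail_mass : ∫⁻ x, ENNReal.ofReal (|x| ^ (p - 1)) * ∫⁻ u in {u | |x| ≤ |u|}, ‖a u‖ₑ ≤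
      2 * ∫⁻ u, ENNReal.ofReal (|u| ^ p) * ‖a u‖ₑ := by
    rw [lintegral_rpow_mul_setLIntegral (by linarith) ham.enorm, ← ENNReal.ofReal_ofNat 2]
    gcongr
    exact div_le_self zero_le_two hp
  have tail_prob : ∫⁻ x, ENNReal.ofReal (|x| ^ (p - 1)) * ν {y | |x| ≤ |y|} ^ (1 / 2 : ℝ) =
      2 * ∫⁻ x in Ioi 0, ENNReal.ofReal (|x| ^ (p - 1)) * ν {y | x ≤ |y|} ^ (1 / 2 : ℝ) := by
    simpa only [abs_abs] using lintegral_comp_abs (f := fun x => ENNReal.ofReal (|x| ^ (p - 1)) *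
      ν {y | x ≤ |y|} ^ (1 / 2 : ℝ)) (by fun_prop)
  calc _ ≤ ∫⁻ x, (ENNReal.ofReal (|x| ^ (p - 1)) * (∫⁻ u in {u | |x| / 2 ≤ |u|}, ‖a u‖ₑ) +
        N * (ENNReal.ofReal (|x| ^ (p - 1)) * ν {y | |x| / 2 ≤ |y|} ^ (1 / 2 : ℝ))) := by
        refine lintegral_mono fun x => ?_
        rw [mul_left_comm N, ← mul_add]
        gcongr
        exact lintegral_sq_primitive_sub_rpow_half_le ha ν x
    _ = ENNReal.ofReal (2 ^ p) *
        ((∫⁻ x, ENNReal.ofReal (|x| ^ (p - 1)) * ∫⁻ u in {u | |x| ≤ |u|}, ‖a u‖ₑ) +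
          N * ∫⁻ x, ENNReal.ofReal (|x| ^ (p - 1)) * ν {y | |x| ≤ |y|} ^ (1 / 2 : ℝ)) := by
        rw [lintegral_add_left tail_measurable, lintegral_const_mul' _ _ ha.2.ne,
          lintegral_rpow_mul_comp_half p fun c => ∫⁻ u in {u | c ≤ |u|}, ‖a u‖ₑ,
          lintegral_rpow_mul_comp_half p fun c => ν {y | c ≤ |y|} ^ (1 / 2 : ℝ), mul_add,
          mul_left_comm N]
    _ ≤ _ := by
        rw [ENNReal.ofReal_mul (by positivity), ENNReal.ofReal_ofNat, mul_assoc, mul_add 2,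
          mul_left_comm 2 N, ← tail_prob]
        gcongr

end PrimitiveStdDev

section DensityStdDev

theorem one_add_abs_add_rpow_le {s a : ℝ} {m : ℕ} (hs : 0 ≤ s) (hsa : s ≤ a) (hsm : s ≤ m)
    (y z : ℝ) : (1 + |z + y|) ^ s ≤ 3 ^ s * (1 + |y| ^ a + |z| ^ m) := by
  set M := max 1 (max |y| |z|) with hM
  have hM1 : 1 ≤ M := le_max_left _ _
  have hle : 1 + |z + y| ≤ 3 * M := by
    have hy : |y| ≤ M := (le_max_left _ _).trans (le_max_right _ _)
    have hz : |z| ≤ M := (le_max_right _ _).trans (le_max_right _ _)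
    linarith [abs_add_le z y]
  have hMs : M ^ s ≤ 1 + |y| ^ a + |z| ^ m := by
    have hya : 0 ≤ |y| ^ a := by positivity
    have hzm : 0 ≤ |z| ^ m := by positivity
    rcases max_choice 1 (max |y| |z|) with h | h
    · rw [hM, h, Real.one_rpow]
      linarith
    rcases max_choice |y| |z| with h' | h' <;> rw [← hM, h'] at h
    · have := Real.rpow_le_rpow_of_exponent_le hM1 hsa
      rw [h] at this ⊢
      linarith
    · have := Real.rpow_le_rpow_of_exponent_le hM1 hsm
      rw [h, Real.rpow_natCast] at this
      rw [h]
      linarith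
  calc (1 + |z + y|) ^ s ≤ (3 * M) ^ s := by gcongr
    _ = 3 ^ s * M ^ s := Real.mul_rpow (by norm_num) (by positivity)
    _ ≤ _ := by gcongr

theorem lintegral_mul_lintegral_comp_sub {w g : ℝ → ℝ≥0∞} (hw : Measurable w) (hg : Measurable g)
    (ν : Measure ℝ) [SFinite ν] :
    ∫⁻ x, w x * ∫⁻ y, g (x - y) ∂ν = ∫⁻ y, (∫⁻ z, w (z + y) * g z) ∂ν := by
  calc _ = ∫⁻ x, ∫⁻ y, w x * g (x - y) ∂ν :=
        lintegral_congr fun x => (lintegral_const_mul _ (by fun_prop)).symm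
    _ = ∫⁻ y, (∫⁻ x, w x * g (x - y)) ∂ν := lintegral_lintegral_swap (by fun_prop)
    _ = _ := lintegral_congr fun y => by
        simpa only [add_sub_cancel_right] using
          (lintegral_add_right_eq_self (fun x => w x * g (x - y)) y).symm

theorem lintegral_one_add_abs_rpow_mul_le {s a : ℝ} {m : ℕ} (hs : 0 ≤ s) (hsa : s ≤ a)
    (hsm : s ≤ m) {g : ℝ → ℝ≥0∞} (hg : Measurable g) (ν : Measure ℝ) [IsProbabilityMeasure ν] :
    ∫⁻ x, ENNReal.ofReal ((1 + |x|) ^ s) * ∫⁻ y, g (x - y) ∂ν ≤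
      ENNReal.ofReal (3 ^ s) * ((1 + ∫⁻ y, ENNReal.ofReal (|y| ^ a) ∂ν) * (∫⁻ z, g z) +
        ∫⁻ z, ENNReal.ofReal (|z| ^ m) * g z) := by
  calc _ = ∫⁻ y, (∫⁻ z, ENNReal.ofReal ((1 + |z + y|) ^ s) * g z) ∂ν :=
        lintegral_mul_lintegral_comp_sub (by fun_prop) hg ν
    _ ≤ ∫⁻ y, (∫⁻ z, ENNReal.ofReal (3 ^ s) * ((1 + ENNReal.ofReal (|y| ^ a)) * g z +
          ENNReal.ofReal (|z| ^ m) * g z)) ∂ν := by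
        refine lintegral_mono fun y => lintegral_mono fun z => ?_
        rw [← add_mul, ← mul_assoc, ← ENNReal.ofReal_one,
          ← ENNReal.ofReal_add zero_le_one (by positivity),
          ← ENNReal.ofReal_add (by positivity) (by positivity),
          ← ENNReal.ofReal_mul (by positivity)]
        gcongr
        exact one_add_abs_add_rpow_le hs hsa hsm y z
    _ = ∫⁻ y, ENNReal.ofReal (3 ^ s) * ((1 + ENNReal.ofReal (|y| ^ a)) * (∫⁻ z, g z) +
          ∫⁻ z, ENNReal.ofReal (|z| ^ m) * g z) ∂ν := by
        refine lintegral_congr fun y => ?_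
        rw [lintegral_const_mul' _ _ ENNReal.ofReal_ne_top, lintegral_add_left (by fun_prop),
          lintegral_const_mul _ hg]
    _ = _ := by
        rw [lintegral_const_mul' _ _ ENNReal.ofReal_ne_top, lintegral_add_left (by fun_prop),
          lintegral_mul_const _ (by fun_prop), lintegral_add_left measurable_const,
          lintegral_const, lintegral_const, measure_univ, mul_one, mul_one]

theorem exists_weightedStdDev_zero_le {p a : ℝ} (hp : 1 ≤ p) (ha : 2 * p - 1 < a) {m : ℕ}
    (hm : 2 * p - 1 < m) :
    ∃ C : ℝ≥0, ∀ (f : ℝ → ℝ) (ν : Measure ℝ), Measurable f → IsProbabilityMeasure ν →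
      weightedStdDev p ν f 0 ≤ C * ((1 + ∫⁻ y, ENNReal.ofReal (|y| ^ a) ∂ν) * (∫⁻ z, ‖f z‖ₑ ^ 2) +
        ∫⁻ z, ENNReal.ofReal (|z| ^ m) * ‖f z‖ₑ ^ 2) ^ (1 / 2 : ℝ) := by
  set s : ℝ := min a m
  have hs : 2 * (p - 1) + 1 < s := lt_min (by linarith) (by linarith)
  obtain ⟨C, hC⟩ := exists_lintegral_rpow_mul_le (q := p - 1) (by linarith) hs
  refine ⟨C * ((ENNReal.ofReal (3 ^ s)) ^ (1 / 2 : ℝ)).toNNReal, fun f ν hf hν => ?_⟩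
  have variance_measurable := measurable_lintegral_sub_sq (ν := ν) hf measurable_zero
  have rpow_half_sq (t : ℝ≥0∞) : (t ^ (1 / 2 : ℝ)) ^ 2 = t := by
    simpa using ENNReal.rpow_inv_natCast_pow two_ne_zero t
  have ofReal_sq (t : ℝ) : ENNReal.ofReal ((t - 0) ^ 2) = ‖t‖ₑ ^ 2 := by
    rw [sub_zero, ← sq_abs, ENNReal.ofReal_pow (abs_nonneg _), Real.enorm_eq_ofReal_abs]
  refine (hC _ (variance_measurable.pow_const _)).trans ?_
  push_cast
  rw [ENNReal.coe_toNNReal (ENNReal.rpow_ne_top_of_nonneg (by norm_num) ENNReal.ofReal_ne_top),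
    mul_assoc, ← ENNReal.mul_rpow_of_nonneg _ _ one_half_pos.le]
  simp only [rpow_half_sq, Pi.zero_apply, ofReal_sq]
  gcongr
  exact lintegral_one_add_abs_rpow_mul_le (by linarith) (min_le_left _ _) (min_le_right _ _)
    (by fun_prop) ν

end DensityStdDev

/-! ### The risk of the estimator -/

section Orders

theorem lt_leastGt (x : ℝ) : x < leastGt x := by
  rw [leastGt]
  exact_mod_cast Nat.lt_floor_add_one x

theorem leastGt_add_one {x : ℝ} (hx : 0 ≤ x) : leastGt (x + 1) = leastGt x + 1 := by
  rw [leastGt, leastGt, Nat.floor_add_one hx]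

theorem leastGt_add_half {p : ℝ} (hp : 1 ≤ p) : leastGt (p + 1 / 2) = leastGt (p - 1 / 2) + 1 := by
  rw [← leastGt_add_one (by linarith)]
  ring_nf

theorem leastGt_sub_half_le {p : ℝ} (hp : 1 ≤ p) : leastGt (p - 1 / 2) ≤ ⌈p⌉₊ := by
  rw [leastGt, Nat.add_one_le_iff, Nat.lt_ceil]
  linarith [Nat.floor_le (show 0 ≤ p - 1 / 2 by linarith)]

end Orders

section SupDeriv

variable {r : ℝ → ℂ} {m l : ℕ}

theorem ofReal_norm_iteratedDeriv_le_supDeriv (r : ℝ → ℂ) {t : ℝ} (ht : t ∈ Icc (-2 : ℝ) 2)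
    (hl : l ≤ m) : ENNReal.ofReal ‖iteratedDeriv l r t‖ ≤ supDeriv r m :=
  (Finset.single_le_sum (f := fun l => ENNReal.ofReal ‖iteratedDeriv l r t‖)
    (fun _ _ => zero_le) (Finset.mem_range_succ_iff.2 hl)).trans
    (le_iSup₂ (f := fun t (_ : t ∈ Icc (-2 : ℝ) 2) =>
      ∑ l ∈ Finset.range (m + 1), ENNReal.ofReal ‖iteratedDeriv l r t‖) t ht)

theorem supDeriv_ne_top (hr : ContDiff ℝ m r) : supDeriv r m ≠ ∞ := by
  have hc : Continuous fun t => ∑ l ∈ Finset.range (m + 1), ‖iteratedDeriv l r t‖ :=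
    continuous_finsetSum _ fun l hl => (hr.continuous_iteratedDeriv l
      (by exact_mod_cast Finset.mem_range_succ_iff.1 hl)).norm
  obtain ⟨C, hC⟩ := (isCompact_Icc (a := (-2 : ℝ)) (b := 2)).exists_bound_of_continuousOn
    hc.continuousOn
  refine ne_top_of_le_ne_top (ENNReal.ofReal_ne_top (r := C)) (iSup₂_le fun t ht => ?_)
  rw [← ENNReal.ofReal_sum_of_nonneg fun _ _ => norm_nonneg _]
  exact ENNReal.ofReal_le_ofReal ((le_abs_self _).trans (hC t ht))

theorem one_le_supDeriv_recipChar (με : Measure ℝ) [IsProbabilityMeasure με] (m : ℕ) :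
    1 ≤ supDeriv (recipChar με) m := by
  simpa [recipChar] using ofReal_norm_iteratedDeriv_le_supDeriv (recipChar με) (t := 0)
    (by norm_num) m.zero_le

end SupDeriv

section LowFrequency

theorem enorm_density_le (g : ℝ → ℂ) (x : ℝ) : ‖density g x‖ₑ ≤ ‖ft g x‖ₑ := by
  rw [← ofReal_norm, ← ofReal_norm]
  exact ENNReal.ofReal_le_ofReal (abs_density_le g x)

theorem IsKernel.exists_lintegral_rpow_mul_density_lowSymbol_le {p : ℝ} {k : ℝ → ℝ}
    (hk : IsKernel p k) {q : ℝ} (hq : 0 ≤ q) {m : ℕ} (hm : m ≤ ⌈p⌉₊) (hqm : q + 1 / 2 < m + 1) :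
    ∃ C : ℝ≥0, ∀ (h : ℝ) (r : ℝ → ℂ), 0 < h → h ≤ 1 → ContDiff ℝ (m + 1 : ℕ) r →
      ∫⁻ x, ENNReal.ofReal (|x| ^ q) * ‖density (lowSymbol k r h) x‖ₑ ≤
        C * supDeriv r (m + 1) := by
  obtain ⟨C, hC⟩ := hk.exists_lintegral_rpow_mul_ft_lowSymbol_le hq hm hqm
  refine ⟨C, fun h r hh hh1 hr => ?_⟩
  have hr_top := supDeriv_ne_top hr
  have hlow := hC h r (supDeriv r (m + 1)).toNNReal hh hh1 hr fun t ht l hl =>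
    (ENNReal.ofReal_le_iff_le_toReal hr_top).1 (ofReal_norm_iteratedDeriv_le_supDeriv r ht hl)
  rw [ENNReal.coe_toNNReal hr_top] at hlow
  refine le_trans ?_ hlow
  gcongr
  exact enorm_density_le _ _

theorem IsKernel.exists_weightedStdDev_lowSymbol_le {p : ℝ} (hp : 1 ≤ p) {k : ℝ → ℝ}
    (hk : IsKernel p k) :
    ∃ C : ℝ≥0, ∀ (h : ℝ) (r : ℝ → ℂ) (ν : Measure ℝ), 0 < h → h ≤ 1 →
      ContDiff ℝ (leastGt (p + 1 / 2)) r → IsProbabilityMeasure ν →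
      weightedStdDev p ν (primitive (density (lowSymbol k r h)))
        (fun x => if x < 0 then 0 else ∫ u, density (lowSymbol k r h) u) ≤
        C * (termA1 p r ν + termA2 p r) := by
  obtain ⟨C₀, hC₀⟩ := hk.exists_lintegral_rpow_mul_density_lowSymbol_le le_rfl zero_le
    (by norm_num)
  obtain ⟨C₁, hC₁⟩ := hk.exists_lintegral_rpow_mul_density_lowSymbol_le (q := p) (by linarith)
    (leastGt_sub_half_le hp) (by linarith [lt_leastGt (p - 1 / 2)])
  refine ⟨(2 ^ p * 2 : ℝ).toNNReal * (C₁ + C₀), fun h r ν hh hh1 hr hν => ?_⟩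
  rw [leastGt_add_half hp] at hr
  have hr1 : ContDiff ℝ (0 + 1 : ℕ) r := hr.of_le (by exact_mod_cast Nat.le_add_left 1 _)
  set a := density (lowSymbol k r h)
  set tail := ∫⁻ x in Ioi 0, ENNReal.ofReal (|x| ^ (p - 1)) * ν {y | x ≤ |y|} ^ (1 / 2 : ℝ)
  have ha : Integrable a := integrable_density
    (hk.contDiff_lowSymbol (Nat.one_le_ceil_iff.2 (by linarith)) hr1 h)
    (hasCompactSupport_lowSymbol k r h)
  have mass_le : ∫⁻ u, ‖a u‖ₑ ≤ C₀ * supDeriv r 1 := by simpa using hC₀ h r hh hh1 hr1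
  have moment_le : ∫⁻ u, ENNReal.ofReal (|u| ^ p) * ‖a u‖ₑ ≤ C₁ * termA2 p r := by
    rw [termA2, leastGt_add_half hp]
    exact hC₁ h r hh hh1 hr
  calc _ ≤ ENNReal.ofReal (2 ^ p * 2) * ((∫⁻ u, ENNReal.ofReal (|u| ^ p) * ‖a u‖ₑ) +
        (∫⁻ u, ‖a u‖ₑ) * tail) := weightedStdDev_primitive_le hp (measurable_density _) ha ν
    _ ≤ ENNReal.ofReal (2 ^ p * 2) * ((C₁ + C₀) * termA2 p r +
        (C₁ + C₀) * supDeriv r 1 * tail) := by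
        gcongr
        · exact moment_le.trans (by gcongr; exact le_self_add)
        · exact mass_le.trans (by gcongr; exact le_add_self)
    _ = _ := by
        rw [termA1, ENNReal.coe_mul, ENNReal.coe_add, ← ENNReal.ofReal]
        ring

end LowFrequency

section HighFrequency

theorem exists_lipschitzWith_iteratedDeriv_of_hasCompactSupport {g : ℝ → ℂ} {m l : ℕ}
    (hg : ContDiff ℝ m g) (hc : HasCompactSupport g) (hl : l < m) :
    ∃ B : ℝ≥0, LipschitzWith B (iteratedDeriv l g) := by
  refine ContDiff.lipschitzWith_of_hasCompactSupport (𝕂 := ℝ) (n := (1 : ℕ))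
    (hasCompactSupport_iteratedDeriv hc l) ?_ (by norm_num)
  rw [iteratedDeriv_eq_iterate]
  exact .iterate_deriv' 1 l (hg.of_le (by exact_mod_cast (by omega)))

theorem lintegral_pow_mul_enorm_sq_density_le {g : ℝ → ℂ} {m : ℕ} (hg : ContDiff ℝ m g)
    (hc : HasCompactSupport g) :
    ∫⁻ x, ENNReal.ofReal (|x| ^ (2 * m)) * ‖density g x‖ₑ ^ 2 ≤
      ENNReal.ofReal (2 * Real.pi) * ∫⁻ v, ‖iteratedDeriv m g v‖ₑ ^ 2 := by
  obtain ⟨B, hB⟩ := exists_norm_iteratedDeriv_le_of_hasCompactSupport hg hc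
  rw [← lintegral_pow_mul_enorm_sq_ft
    (fun l hl => exists_lipschitzWith_iteratedDeriv_of_hasCompactSupport hg hc hl) hc
    (hg.continuous_iteratedDeriv m le_rfl).aestronglyMeasurable (hB m le_rfl)]
  gcongr
  exact enorm_density_le _ _

theorem IsKernel.exists_lintegral_pow_mul_density_highSymbol_le {p : ℝ} {k : ℝ → ℝ}
    (hk : IsKernel p k) {m : ℕ} (hm : m ≤ ⌈p⌉₊) :
    ∃ C : ℝ≥0, ∀ (h : ℝ) (r : ℝ → ℂ), 0 < h → h ≤ 1 → ContDiff ℝ m r → ∀ l ≤ m,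
      ∫⁻ z, ENNReal.ofReal (|z| ^ (2 * l)) * ‖density (highSymbol k r h) z‖ₑ ^ 2 ≤
        C * ∑ j ∈ Finset.range (l + 1), outerIntegral r h j := by
  obtain ⟨C, hC⟩ := hk.exists_lintegral_iteratedDeriv_highSymbol_le hm
  refine ⟨(2 * Real.pi).toNNReal * C, fun h r hh hh1 hr l hl => ?_⟩
  rw [ENNReal.coe_mul, ← ENNReal.ofReal, mul_assoc]
  refine (lintegral_pow_mul_enorm_sq_density_le (hk.contDiff_highSymbol (hl.trans hm)
    (hr.of_le (by exact_mod_cast hl)) h) (hk.hasCompactSupport_highSymbol r hh)).trans ?_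
  gcongr
  exact hC h r hh hh1 hr l hl

theorem IsKernel.exists_moments_density_highSymbol_le {p : ℝ} {k : ℝ → ℝ} (hk : IsKernel p k)
    {m : ℕ} (hm : m ≤ ⌈p⌉₊) :
    ∃ C : ℝ≥0, ∀ (h : ℝ) (r : ℝ → ℂ) (J : ℝ≥0∞), 0 < h → h ≤ 1 → ContDiff ℝ m r →
      (1 + J) * (∫⁻ z, ‖density (highSymbol k r h) z‖ₑ ^ 2) +
        (∫⁻ z, ENNReal.ofReal (|z| ^ (2 * m)) * ‖density (highSymbol k r h) z‖ₑ ^ 2) ≤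
      C * (J * outerIntegral r h 0 + ∑ j ∈ Finset.range (m + 1), outerIntegral r h j) := by
  obtain ⟨C, hC⟩ := hk.exists_lintegral_pow_mul_density_highSymbol_le hm
  refine ⟨2 * C, fun h r J hh hh1 hr => ?_⟩
  set O := ∑ j ∈ Finset.range (m + 1), outerIntegral r h j
  have outer_zero_le : outerIntegral r h 0 ≤ O :=
    Finset.single_le_sum (f := fun j => outerIntegral r h j) (fun _ _ => zero_le)
      (Finset.mem_range_succ_iff.2 m.zero_le)
  have sq_le : ∫⁻ z, ‖density (highSymbol k r h) z‖ₑ ^ 2 ≤ C * outerIntegral r h 0 := by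
    simpa using hC h r hh hh1 hr 0 zero_le
  calc _ ≤ (1 + J) * (C * outerIntegral r h 0) + C * O := by
        gcongr
        exact hC h r hh hh1 hr m le_rfl
    _ = C * (J * outerIntegral r h 0 + (outerIntegral r h 0 + O)) := by ring
    _ ≤ C * ((J * outerIntegral r h 0 + J * outerIntegral r h 0) + (O + O)) := by
        gcongr
        exact le_self_add
    _ = _ := by
        push_cast
        ring

theorem IsKernel.exists_weightedStdDev_highSymbol_le {p : ℝ} (hp : 1 ≤ p) {k : ℝ → ℝ}
    (hk : IsKernel p k) :
    ∃ C : ℝ≥0, ∀ (h : ℝ) (r : ℝ → ℂ) (ν : Measure ℝ), 0 < h → h ≤ 1 →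
      ContDiff ℝ (leastGt (p - 1 / 2)) r → IsProbabilityMeasure ν →
      weightedStdDev p ν (density (highSymbol k r h)) 0 ≤
        C * (termA3 p r ν h + termA4 p r h) := by
  have hm : 2 * p - 1 < (2 * leastGt (p - 1 / 2) : ℕ) := by
    push_cast
    linarith [lt_leastGt (p - 1 / 2)]
  obtain ⟨C₁, hC₁⟩ := hk.exists_moments_density_highSymbol_le (leastGt_sub_half_le hp)
  obtain ⟨C₂, hC₂⟩ := exists_weightedStdDev_zero_le (a := 2 * p - 1 / 2) hp (by linarith) hm
  refine ⟨C₂ * C₁ ^ (1 / 2 : ℝ), fun h r ν hh hh1 hr hν => ?_⟩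
  refine (hC₂ _ ν (measurable_density _) hν).trans ?_
  rw [ENNReal.coe_mul, mul_assoc]
  gcongr
  set J := ∫⁻ y, ENNReal.ofReal (|y| ^ (2 * p - 1 / 2)) ∂ν
  set O := ∑ l ∈ Finset.range (leastGt (p - 1 / 2) + 1), outerIntegral r h l
  calc _ ≤ (C₁ * (J * outerIntegral r h 0 + O)) ^ (1 / 2 : ℝ) :=
        ENNReal.rpow_le_rpow (hC₁ h r J hh hh1 hr) one_half_pos.le
    _ = (C₁ ^ (1 / 2 : ℝ) : ℝ≥0) * (J * outerIntegral r h 0 + O) ^ (1 / 2 : ℝ) := by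
        rw [ENNReal.mul_rpow_of_nonneg _ _ one_half_pos.le,
          ENNReal.coe_rpow_of_nonneg _ one_half_pos.le]
    _ ≤ (C₁ ^ (1 / 2 : ℝ) : ℝ≥0) * (termA3 p r ν h + termA4 p r h) := by
        gcongr
        exact ENNReal.rpow_add_le_add_rpow _ _ one_half_pos.le one_half_lt_one.le

end HighFrequency

section Risk

variable {p : ℝ} {k : ℝ → ℝ} {μ με : Measure ℝ}

theorem measurable_prelimEstimator (k : ℝ → ℝ) (με : Measure ℝ) {h : ℝ} (hh : 0 < h) {n : ℕ}
    (y : Fin n → ℝ) : Measurable (prelimEstimator k με h y) := by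
  have := measurable_density (symbol k (recipChar με) h)
  unfold prelimEstimator
  simp only [deconvKernel_div_eq k με hh]
  exact (measurable_primitive (by fun_prop)).const_mul _

theorem IsKernel.exists_weightedStdDev_symbol_le (hp : 1 ≤ p) (hk : IsKernel p k) :
    ∃ C : ℝ≥0, ∀ (h : ℝ) (r : ℝ → ℂ) (ν : Measure ℝ), 0 < h → h ≤ 1 →
      ContDiff ℝ (leastGt (p + 1 / 2)) r → IsProbabilityMeasure ν →
      ∃ c : ℝ → ℝ, weightedStdDev p ν (primitive (density (symbol k r h))) c ≤
        C * (termA1 p r ν + termA2 p r + termA3 p r ν h + termA4 p r h) := by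
  obtain ⟨C₁, hC₁⟩ := hk.exists_weightedStdDev_lowSymbol_le hp
  obtain ⟨C₂, hC₂⟩ := hk.exists_weightedStdDev_highSymbol_le hp
  refine ⟨C₁ + C₂, fun h r ν hh hh1 hr hν => ?_⟩
  have hr' : ContDiff ℝ (leastGt (p - 1 / 2)) r :=
    hr.of_le (by exact_mod_cast (leastGt_add_half hp).ge.trans' (Nat.le_succ _))
  have hr1 : ContDiff ℝ 1 r := hr.of_le (by exact_mod_cast Nat.succ_pos _)
  have split : primitive (density (symbol k r h)) =
      primitive (density (lowSymbol k r h)) + density (highSymbol k r h) :=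
    funext (hk.primitive_density_symbol_eq (Nat.one_le_ceil_iff.2 (by linarith)) hr1 hh)
  set c := fun x : ℝ => if x < 0 then 0 else ∫ u, density (lowSymbol k r h) u
  have hc : Measurable c := Measurable.ite measurableSet_Iio measurable_const measurable_const
  use c + 0
  calc weightedStdDev p ν (primitive (density (symbol k r h))) (c + 0)
      ≤ weightedStdDev p ν (primitive (density (lowSymbol k r h))) c +
          weightedStdDev p ν (density (highSymbol k r h)) 0 := by
        rw [split]
        exact weightedStdDev_add_le (measurable_primitive (measurable_density _)) hc
          (measurable_density _)
    _ ≤ C₁ * (termA1 p r ν + termA2 p r) + C₂ * (termA3 p r ν h + termA4 p r h) :=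
        add_le_add (hC₁ h r ν hh hh1 hr hν) (hC₂ h r ν hh hh1 hr' hν)
    _ ≤ (C₁ + C₂) * (termA1 p r ν + termA2 p r) +
          (C₁ + C₂) * (termA3 p r ν h + termA4 p r h) := by
        gcongr
        · exact le_self_add
        · exact le_add_self
    _ = _ := by
        push_cast
        ring

theorem IsKernel.lintegral_weightedDist_prelimEstimator_le (hk : IsKernel p k) (hp : 1 ≤ p)
    [IsProbabilityMeasure μ] [IsProbabilityMeasure με] (hne : ∀ t, charFun με t ≠ 0)
    (hr : ContDiff ℝ 1 (recipChar με)) {h : ℝ} (hh : 0 < h) {Ω : Type*} [MeasurableSpace Ω]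
    {P : Measure Ω} [IsProbabilityMeasure P] {n : ℕ} (hn : 1 ≤ n) {Y : Fin n → Ω → ℝ}
    (hY : ∀ i, HasLaw (Y i) (Measure.conv μ με) P)
    (hi : Pairwise fun i j => IndepFun (Y i) (Y j) P) (c : ℝ → ℝ) :
    ∫⁻ ω, weightedDist p (prelimEstimator k με h fun i => Y i ω)
        (cdf (Measure.conv μ (kernelLaw k h))) ∂P ≤
      ENNReal.ofReal ((n : ℝ) ^ (-(1 / 2) : ℝ)) * weightedStdDev p (Measure.conv μ με)
        (primitive (density (symbol k (recipChar με) h))) c := by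
  have hp1 : 1 ≤ ⌈p⌉₊ := Nat.one_le_ceil_iff.2 (by linarith)
  have hi' : Integrable (density (symbol k (recipChar με) h)) :=
    integrable_density (hk.contDiff_symbol hp1 (by exact_mod_cast hr) h)
      (hk.hasCompactSupport_symbol _ hh)
  have estimator_eq (y : Fin n → ℝ) := funext (prelimEstimator_eq hh hi' y)
  have mean_eq := funext (hk.integral_primitive_density_symbol hp1 hh μ με hne hr)
  simp only [estimator_eq, ← mean_eq]
  exact lintegral_weightedDist_mean_le hn hY hi (measurable_primitive (measurable_density _))
    (abs_primitive_le hi') c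

theorem weightedDist_triangle_left (p : ℝ) {F G : ℝ → ℝ} (hF : Measurable F) (hG : Measurable G)
    (H : ℝ → ℝ) : weightedDist p G H ≤ weightedDist p F G + weightedDist p F H := by
  rw [weightedDist, weightedDist, weightedDist, ← lintegral_add_left (by fun_prop)]
  refine lintegral_mono fun x => ?_
  rw [← ENNReal.ofReal_add (by positivity) (by positivity), ← mul_add]
  gcongr
  rw [abs_sub_comm (F x) (G x)]
  exact abs_sub_le _ _ _

theorem wasserstein_rpow_le_of_isIsotoneApprox (hp : 1 ≤ p) {ρ : ℝ} {F : ℝ → ℝ}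
    (hF : Measurable F) {m : ProbabilityMeasure ℝ} (hm : IsIsotoneApprox p ρ F m)
    (μ ζ : Measure ℝ) [IsProbabilityMeasure μ] [IsProbabilityMeasure ζ] :
    wasserstein p m μ ^ p ≤ ENNReal.ofReal (2 ^ (p - 1)) * (ENNReal.ofReal (2 ^ (p - 1)) *
      (ENNReal.ofReal p * (2 * weightedDist p F (cdf (Measure.conv μ ζ)) + ENNReal.ofReal ρ)) +
        ∫⁻ z, ENNReal.ofReal (|z| ^ p) ∂ζ) := by
  refine (wasserstein_rpow_le_weightedDist_conv hp (m : Measure ℝ) μ ζ).trans ?_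
  set D := weightedDist p F (cdf (Measure.conv μ ζ))
  gcongr
  calc weightedDist p (cdf (m : Measure ℝ)) (cdf (Measure.conv μ ζ))
      ≤ weightedDist p F (cdf (m : Measure ℝ)) + D :=
        weightedDist_triangle_left p hF (monotone_cdf (m : Measure ℝ)).measurable _
    _ ≤ (D + ENNReal.ofReal ρ) + D := by
        gcongr
        exact hm ⟨Measure.conv μ ζ, inferInstance⟩
    _ = 2 * D + ENNReal.ofReal ρ := by ring

theorem lintegral_wasserstein_rpow_le (hp : 1 ≤ p) {ρ : ℝ} {Ω : Type*} [MeasurableSpace Ω]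
    (P : Measure Ω) [IsProbabilityMeasure P] {F : Ω → ℝ → ℝ} (hF : ∀ ω, Measurable (F ω))
    {m : Ω → ProbabilityMeasure ℝ} (hm : ∀ ω, IsIsotoneApprox p ρ (F ω) (m ω))
    (μ ζ : Measure ℝ) [IsProbabilityMeasure μ] [IsProbabilityMeasure ζ] :
    ∫⁻ ω, wasserstein p (m ω) μ ^ p ∂P ≤
      ENNReal.ofReal (2 ^ (p - 1)) * (ENNReal.ofReal (2 ^ (p - 1)) * (ENNReal.ofReal p *
        (2 * ∫⁻ ω, weightedDist p (F ω) (cdf (Measure.conv μ ζ)) ∂P + ENNReal.ofReal ρ)) +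
          ∫⁻ z, ENNReal.ofReal (|z| ^ p) ∂ζ) := by
  refine (lintegral_mono fun ω => wasserstein_rpow_le_of_isIsotoneApprox hp (hF ω) (hm ω) μ ζ).trans
    (le_of_eq ?_)
  rw [lintegral_const_mul' _ _ ENNReal.ofReal_ne_top, lintegral_add_right _ measurable_const,
    lintegral_const_mul' _ _ ENNReal.ofReal_ne_top, lintegral_const_mul' _ _ ENNReal.ofReal_ne_top,
    lintegral_add_right _ measurable_const, lintegral_const_mul' _ _ ENNReal.ofNat_ne_top]
  simp only [lintegral_const, measure_univ, mul_one]

end Risk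

section Observations

variable {μ με : Measure ℝ} [IsProbabilityMeasure μ] [IsProbabilityMeasure με] {Ω ι : Type*}
  [MeasurableSpace Ω] {P : Measure Ω} {X ε : ι → Ω → ℝ}

theorem hasLaw_add_conv (hX : ∀ i, HasLaw (X i) μ P) (hε : ∀ i, HasLaw (ε i) με P)
    (hXε : IndepFun (fun ω i => X i ω) (fun ω i => ε i ω) P) (i : ι) :
    HasLaw (fun ω => X i ω + ε i ω) (Measure.conv μ με) P :=
  (hXε.comp (measurable_pi_apply i) (measurable_pi_apply i)).hasLaw_fun_add (hX i) (hε i)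

theorem iIndepFun_add [IsProbabilityMeasure P] [Finite ι] (hX : ∀ i, AEMeasurable (X i) P)
    (hε : ∀ i, AEMeasurable (ε i) P) (iX : iIndepFun X P) (iε : iIndepFun ε P)
    (hXε : IndepFun (fun ω i => X i ω) (fun ω i => ε i ω) P) :
    iIndepFun (fun i ω => X i ω + ε i ω) P :=
  (iIndepFun_prodMk hX hε iX iε hXε).comp (fun _ z => z.1 + z.2) fun _ => by fun_prop

end Observations

end WassersteinDeconvolution

open WassersteinDeconvolution in
theorem proposition1_general (p : ℝ) (hp : 1 ≤ p) (k : ℝ → ℝ) (hk : IsKernel p k) :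
    ∃ C : ℝ≥0, ∀ (n : ℕ) (_ : 1 ≤ n) (h : ℝ) (_ : 0 < h) (_ : h ≤ 1)
      (ρ : ℝ) (_ : 0 ≤ ρ) (_ : ρ ≤ (n : ℝ) ^ (-(1 / 2) : ℝ))
      (μ με : Measure ℝ) [IsProbabilityMeasure μ] [IsProbabilityMeasure με]
      (_ : ∀ t, charFun με t ≠ 0)
      (_ : ContDiff ℝ (leastGt (p + 1 / 2) : ℕ) (recipChar με))
      {Ω : Type*} [MeasurableSpace Ω] (P : Measure Ω) [IsProbabilityMeasure P]
      (Y : Fin n → Ω → ℝ)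
      (_ : ∀ i, HasLaw (Y i) (Measure.conv μ με) P)
      (_ : Pairwise fun i j => IndepFun (Y i) (Y j) P)
      (μn : Ω → ProbabilityMeasure ℝ)
      (_ : ∀ ω, IsIsotoneApprox p ρ (prelimEstimator k με h (fun i => Y i ω)) (μn ω)),
      (∫⁻ ω, wasserstein p (μn ω) μ ^ p ∂P) ≤
        ENNReal.ofReal (h ^ p * 2 ^ (p - 1)) * (∫⁻ x, ENNReal.ofReal (|x| ^ p * k x))
        + C * ENNReal.ofReal ((n : ℝ) ^ (-(1 / 2) : ℝ)) *
          (termA1 p (recipChar με) (Measure.conv μ με) + termA2 p (recipChar με)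
            + termA3 p (recipChar με) (Measure.conv μ με) h + termA4 p (recipChar με) h) := by
  obtain ⟨C, hC⟩ := hk.exists_weightedStdDev_symbol_le hp
  set a := (2 ^ (p - 1) : ℝ).toNNReal
  refine ⟨a * (a * (p.toNNReal * (2 * C + 1))), ?_⟩
  intro n hn h hh hh1 ρ _ hρ μ με _ _ hne hr Ω _ P _ Y hY hi μn hμn
  have := hk.isProbabilityMeasure_kernelLaw h
  set N : ℝ≥0∞ := ENNReal.ofReal ((n : ℝ) ^ (-(1 / 2) : ℝ))
  set A := termA1 p (recipChar με) (Measure.conv μ με) + termA2 p (recipChar με)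
    + termA3 p (recipChar με) (Measure.conv μ με) h + termA4 p (recipChar με) h
  have one_le_A : 1 ≤ A := (one_le_supDeriv_recipChar με _).trans
    (le_add_self.trans (le_self_add.trans le_self_add))
  obtain ⟨c, hc⟩ := hC h (recipChar με) (Measure.conv μ με) hh hh1 hr inferInstance
  have estimator_risk := (hk.lintegral_weightedDist_prelimEstimator_le hp hne
    (hr.of_le (by exact_mod_cast Nat.succ_pos _)) hh hn hY hi c).trans (mul_le_mul_right hc N)
  have slack : ENNReal.ofReal ρ ≤ N * A :=
    (ENNReal.ofReal_le_ofReal hρ).trans (le_mul_of_one_le_right zero_le one_le_A)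
  calc _ ≤ _ := lintegral_wasserstein_rpow_le hp P
        (fun ω => measurable_prelimEstimator k με hh fun i => Y i ω) hμn μ (kernelLaw k h)
    _ ≤ ENNReal.ofReal (2 ^ (p - 1)) * (ENNReal.ofReal (2 ^ (p - 1)) * (ENNReal.ofReal p *
          (2 * (N * (C * A)) + N * A)) +
            ENNReal.ofReal (h ^ p) * ∫⁻ x, ENNReal.ofReal (|x| ^ p * k x)) := by
        rw [hk.lintegral_rpow_kernelLaw hh]
        gcongr
    _ = _ := by
        rw [ENNReal.ofReal_mul (by positivity)]
        simp only [ENNReal.ofReal]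
        push_cast
        ring

open WassersteinDeconvolution in
theorem proposition1 (p : ℝ) (hp : 1 ≤ p) (k : ℝ → ℝ) (hk : IsKernel p k) :
    ∃ C : ℝ≥0, ∀ (n : ℕ) (_ : 1 ≤ n) (h : ℝ) (_ : 0 < h) (_ : h ≤ 1)
      (ρ : ℝ) (_ : 0 ≤ ρ) (_ : ρ ≤ (n : ℝ) ^ (-(1 / 2) : ℝ))
      (μ με : Measure ℝ) [IsProbabilityMeasure μ] [IsProbabilityMeasure με]
      (_ : ∀ t, charFun με t ≠ 0)
      (_ : ContDiff ℝ (leastGt (p + 1 / 2) : ℕ) (recipChar με))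
      {Ω : Type*} [MeasurableSpace Ω] (P : Measure Ω) [IsProbabilityMeasure P]
      (X ε : Fin n → Ω → ℝ)
      (_ : ∀ i, HasLaw (X i) μ P) (_ : ∀ i, HasLaw (ε i) με P)
      (_ : iIndepFun X P) (_ : iIndepFun ε P)
      (_ : IndepFun (fun ω i => X i ω) (fun ω i => ε i ω) P)
      (μn : Ω → ProbabilityMeasure ℝ)
      (_ : ∀ ω, IsIsotoneApprox p ρ
        (prelimEstimator k με h (fun i => X i ω + ε i ω)) (μn ω)),
      (∫⁻ ω, wasserstein p (μn ω) μ ^ p ∂P) ≤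
        ENNReal.ofReal ((n : ℝ) ^ (-(1 / 2) : ℝ))
        + ENNReal.ofReal (h ^ p * 2 ^ (p - 1)) * (∫⁻ x, ENNReal.ofReal (|x| ^ p * k x))
        + C * ENNReal.ofReal ((n : ℝ) ^ (-(1 / 2) : ℝ)) *
          (termA1 p (recipChar με) (Measure.conv μ με) + termA2 p (recipChar με)
            + termA3 p (recipChar με) (Measure.conv μ με) h + termA4 p (recipChar με) h) := by
  obtain ⟨C, hC⟩ := proposition1_general p hp k hk
  exact ⟨C, fun n hn h hh hh1 ρ hρ₀ hρ μ με _ _ hne hr Ω _ P _ X ε hX hε iX iε hXε μn hμn =>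
    (hC n hn h hh hh1 ρ hρ₀ hρ μ με hne hr P _ (hasLaw_add_conv hX hε hXε)
      (fun _ _ hij => (iIndepFun_add (fun i => (hX i).aemeasurable)
        (fun i => (hε i).aemeasurable) iX iε hXε).indepFun hij) μn hμn).trans
      (add_le_add_left le_add_self _)⟩
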